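/- **Setting.** Let $\mathcal G$ be a finite connected graph with at least two nodes (the agents) and diameter $D=D(\mathcal G)\ge 1$, let $d\ge 1$, $b\in\mathbb N$, $G>0$, $\nu>0$. In each round $t=1,\dots,T$ an adversary activates a node $I_t$, which plays $w_t\in\mathbb R^d$; a convex loss $\ell_t:\mathbb R^d\to\mathbb R$ is chosen and $I_t$ receives a subgradient $g_t\in\partial \ell_t(w_t)$ with $\|g_t\|\le G$ (Euclidean norm). The joint regret is $\mathcal R_T(u)=\sum_{t=1}^T(\ell_t(w_t)-\ell_t(u))$. **Encoding and communication.** Let $k=\lfloor b/D\rfloor$ and $\varepsilon=3\cdot 2^{-k/d}G$. A $k$-bit covering code consists of $2^k$ centres, indexed by $\{0,1\}^k$, such that the balls of radius $\varepsilon$ around them cover $\{x:\|x\|\le G\}$, together with a deterministic map sending each $x$ with $\|x\|\le G$ to the index of a ball containing it. Write $\hat g_t$ for the centre to which $g_t$ is encoded. At the end of round $t$ node $I_t$ sends the codeword of $g_t$ to its neighbours, and every node forwards each codeword it has newly received to its neighbours at the end of the next round, each codeword being forwarded during the $D$ rounds $t,\dots,t+D-1$ only. Let $S_t\subseteq\{1,\dots,t-1\}$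 be the set of $s$ such that $I_t$ holds the codeword of $g_s$ at the start of round $t$, let $\gamma(t)=\{1,\dots,t-1\}\setminus S_t$, and let $$\Lambda_T=\sum_{t=1}^T\Big(\|g_t\|^2+2\|g_t\|\sum_{i\in\gamma(t)}\|g_i\|\Big).$$ **Algorithm.** The prediction is $w_t=v_tz_t$. The direction $z_t$ is given by AdaDelay-Dist (delayed dual averaging on the unit ball, run with the gradient bound $4G$): $z_t=\arg\min_{\|z\|\le1}\big\{\langle\sum_{s\in S_t}\hat g_s,z\rangle+\|z\|^2/(2\eta_t)\big\}$ with $$\eta_t=\Big(8D^2(4G)^2+\sum_{s\in S_t}\big(\|\hat g_s\|^2+2\|\hat g_s\|\sum_{i\in\gamma(s)\cap S_t}\|\hat g_i\|\big)\Big)^{-1/2}.$$ The scale is, with $\hat h_s=\langle z_s,\hat g_s\rangle$, $$v_t=\mathbb E_{\eta\sim\rho}\Big[\nu\,\eta\exp\Big(-\sum_{s\in S_t}\big(\eta(\hat h_s+\varepsilon)+\eta^2(\hat h_s+\varepsilon)^2+2\eta^2|\hat h_s+\varepsilon|\sum_{i\in\gamma(s)\cap S_t}|\hat h_i+\varepsilon|\big)\Big)\Big],$$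 where $\rho$ has density proportional to $e^{-\eta^2}$ on $[0,a]$ with $a=\big(20(4G+\varepsilon)(1+2D)\big)^{-1}$. **Theorem (Regret bound with deterministic coding).** There is an absolute constant $C>0$ such that, in every such setting, a $k$-bit covering code exists, and for every such code, every $T$, every activation sequence and all losses and subgradients as above: every node sends at most $b$ bits (of codewords) to each neighbour in every round, and for all $u\in\mathbb R^d$ $$\mathcal R_T(u)\le \nu+\|u\|\,\mathcal B(T),\qquad \mathcal B(T)= C\Big(\sqrt{(\Lambda_T+1)\,L}+G\,D\,L+T\,2^{-b/(dD)}\,G\Big),$$ where $L=\ln\!\big(e+\|u\|\,G\,D\,T/\nu\big)$; that is, $\mathcal B(T)=\tilde{\mathcal O}\big(\sqrt{\Lambda_T}+T2^{-b/(dD)}G\big)$ up to the logarithmic factor $L$ and the lower-order terms $\sqrt{L}$ and $GDL$. -/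

import Mathlib

namespace DOCO

noncomputable section

/-- The space `ℝ^d` with its Euclidean norm. -/
abbrev Vec (d : ℕ) := EuclideanSpace ℝ (Fin d)

/-! ### The network: standard forwarding of the (encoded) gradients

Rounds are numbered `0, 1, 2, …`. The gradient produced in round `s` is identified by its
time stamp `s`; the node `I s` is the one that is active in round `s`. -/

/-- What a node holds at the beginning of a round: the time stamps of all encoded gradients it
has stored, and those among them that arrived at the end of the previous round and have not been
forwarded yet. -/
structure NodeState where
  stored : Finset ℕ
  fresh : Finset ℕ

section Network

variable {V : Type*}

open Classical in
/-- The time stamp of the gradient that node `n` itself produces in round `t`, if any. -/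
def produced (I : ℕ → V) (t : ℕ) (n : V) : Finset ℕ :=
  if I t = n then {t} else ∅

/-- The time stamps of the encoded gradients that node `n` sends to all its neighbours at the end
of round `t`, when the nodes are in state `σ`: its own new gradient and those it has just
received. A gradient is forwarded for `D` rounds only (`D` the diameter of the graph), which
is enough to reach every node. -/
def outgoing (Gr : SimpleGraph V) (I : ℕ → V) (t : ℕ) (σ : V → NodeState) (n : V) : Finset ℕ :=
  ((σ n).fresh ∪ produced I t n).filter (fun s => t < s + Gr.diam)

open Classical in
/-- The time stamps that node `n` receives from its neighbours at the end of round `t`. -/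
def incoming (Gr : SimpleGraph V) (I : ℕ → V) (t : ℕ) (σ : V → NodeState) (n : V) : Finset ℕ :=
  (Finset.range (t + 1)).filter (fun s => ∃ m, Gr.Adj n m ∧ s ∈ outgoing Gr I t σ m)

/-- The states of all nodes at the beginning of each round. -/
def network (Gr : SimpleGraph V) (I : ℕ → V) : ℕ → V → NodeState
  | 0 => fun _ => ⟨∅, ∅⟩
  | t + 1 => fun n =>
      ⟨(network Gr I t n).stored ∪ produced I t n ∪ incoming Gr I t (network Gr I t) n,
        incoming Gr I t (network Gr I t) n \ ((network Gr I t n).stored ∪ produced I t n)⟩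

/-- `S_{I_t}(t)`: the time stamps of the gradients available to the active node in round `t`. -/
def avail (Gr : SimpleGraph V) (I : ℕ → V) (t : ℕ) : Finset ℕ :=
  (network Gr I t (I t)).stored

/-- `γ(t)`: the time stamps of the past gradients that the active node misses in round `t`. -/
def missing (Gr : SimpleGraph V) (I : ℕ → V) (t : ℕ) : Finset ℕ :=
  Finset.range t \ avail Gr I t

/-- The number of bits that node `n` sends to each of its neighbours at the end of round `t`
when every gradient is encoded by `k` bits. -/
def bitsSent (Gr : SimpleGraph V) (I : ℕ → V) (k t : ℕ) (n : V) : ℕ :=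
  k * (outgoing Gr I t (network Gr I t) n).card

/-- The lag `Λ_T = ∑_{t < T} (‖g_t‖² + 2 ‖g_t‖ ∑_{i ∈ γ(t)} ‖g_i‖)`. -/
def lag {d : ℕ} (Gr : SimpleGraph V) (I : ℕ → V) (g : ℕ → Vec d) (T : ℕ) : ℝ :=
  ∑ t ∈ Finset.range T, (‖g t‖ ^ 2 + 2 * ‖g t‖ * ∑ i ∈ missing Gr I t, ‖g i‖)

end Network

/-! ### Deterministic encoding -/

/-- The radius `3 · 2^{-k/d} · G` of the balls of the covering. -/
def coverRadius (d k : ℕ) (G : ℝ) : ℝ :=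
  3 * (2 : ℝ) ^ (-((k : ℝ) / (d : ℝ))) * G

/-- A `k`-bit deterministic code for the vectors of norm at most `G`: a family of `2^k` centres,
indexed by the `k`-bit strings, whose balls of radius `3 · 2^{-k/d} · G` cover the ball of radius
`G`, together with a map `encode` that sends a vector to (the index of) a ball containing it. -/
structure CoverCode (d k : ℕ) (G : ℝ) where
  center : (Fin k → Bool) → Vec d
  encode : Vec d → (Fin k → Bool)
  mem_ball : ∀ x : Vec d, ‖x‖ ≤ G → ‖x - center (encode x)‖ ≤ coverRadius d k G

/-- The vector that is recovered from the codeword of `x`. -/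
def CoverCode.approx {d k : ℕ} {G : ℝ} (c : CoverCode d k G) (x : Vec d) : Vec d :=
  c.center (c.encode x)

/-! ### The algorithm for the direction: AdaDelay-Dist on the unit ball

Below, `S t` stands for the set of available time stamps in round `t`, and `γ t` for the set of
missing ones. -/

/-- The learning rate `1 / √(8 D² M² + Γ_t)` of AdaDelay-Dist, where `M` bounds the norms
of the gradients `x s`, `D` bounds the delay, and `Γ_t` is the part of the lag that is made up of
the gradients that are available in round `t`. -/
def adaRate {d : ℕ} (D : ℕ) (M : ℝ) (S γ : ℕ → Finset ℕ) (x : ℕ → Vec d) (t : ℕ) : ℝ :=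
  (√(8 * (D : ℝ) ^ 2 * M ^ 2 +
    ∑ s ∈ S t, (‖x s‖ ^ 2 + 2 * ‖x s‖ * ∑ i ∈ γ s ∩ S t, ‖x i‖)))⁻¹

/-- The Euclidean projection onto the closed unit ball. -/
def projUnitBall {d : ℕ} (y : Vec d) : Vec d :=
  (max 1 ‖y‖)⁻¹ • y

/-- The prediction `z_t` of AdaDelay-Dist: dual averaging over the available gradients, that is,
the minimiser of `⟨∑_{s ∈ S t} x_s, z⟩ + ‖z‖² / (2 η_t)` over the unit ball. -/
def adaDelayDist {d : ℕ} (D : ℕ) (M : ℝ) (S γ : ℕ → Finset ℕ) (x : ℕ → Vec d) (t : ℕ) : Vec d :=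
  projUnitBall (-(adaRate D M S γ x t • ∑ s ∈ S t, x s))

/-! ### The one-dimensional comparator-adaptive algorithm for the scale -/

/-- The exponent
`∑_{s ∈ S t} (η (h_s + ε) + η² (h_s + ε)² + 2 η² |h_s + ε| ∑_{i ∈ γ s ∩ S t} |h_i + ε|)`. -/
def scaleExponent (ε : ℝ) (S γ : ℕ → Finset ℕ) (h : ℕ → ℝ) (t : ℕ) (η : ℝ) : ℝ :=
  ∑ s ∈ S t, (η * (h s + ε) + η ^ 2 * (h s + ε) ^ 2 +
    2 * η ^ 2 * (|h s + ε| * ∑ i ∈ γ s ∩ S t, |h i + ε|))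

/-- The upper end `1 / (20 (M + ε) (1 + 2D))` of the range of `η`. -/
def etaMax (D : ℕ) (M ε : ℝ) : ℝ :=
  ((M + ε) * 20 * (1 + 2 * (D : ℝ)))⁻¹

/-- The prediction `v_t = 𝔼_{η ∼ ρ} [ν exp(-scaleExponent) η]`, where `ρ` has density proportional
to `exp(-η²)` on `[0, etaMax]`. -/
def scale (D : ℕ) (M ε ν : ℝ) (S γ : ℕ → Finset ℕ) (h : ℕ → ℝ) (t : ℕ) : ℝ :=
  (∫ η in (0 : ℝ)..etaMax D M ε,
      ν * Real.exp (-scaleExponent ε S γ h t η) * η * Real.exp (-η ^ 2)) /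
    ∫ η in (0 : ℝ)..etaMax D M ε, Real.exp (-η ^ 2)

/-! ### The full algorithm -/

/-- The joint prediction `w_t = v_t z_t` on the graph `Gr` with activation sequence `I` and
code `c`, when the gradients are `g`. The approximate gradients `ĝ_s` are the decoded ones,
whose norms are at most `4 G`; the direction `z_t` is learned by AdaDelay-Dist from the `ĝ_s`, and
the scale `v_t` by the one-dimensional algorithm from the `⟨z_s, ĝ_s⟩`, with error
parameter `3 · 2^{-k/d} · G`. -/
def play {V : Type*} {d k : ℕ} {G : ℝ} (Gr : SimpleGraph V) (ν : ℝ) (c : CoverCode d k G)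
    (I : ℕ → V) (g : ℕ → Vec d) (t : ℕ) : Vec d :=
  let S : ℕ → Finset ℕ := avail Gr I
  let γ : ℕ → Finset ℕ := missing Gr I
  let ĝ : ℕ → Vec d := fun s => c.approx (g s)
  let z : ℕ → Vec d := adaDelayDist Gr.diam (4 * G) S γ ĝ
  let v : ℕ → ℝ :=
    scale Gr.diam (4 * G) (coverRadius d k G) ν S γ (fun s => inner ℝ (z s) (ĝ s))
  v t • z t

/-- `g` is a subgradient at `w` of the function `f`. -/
def IsSubgradient {d : ℕ} (f : Vec d → ℝ) (w g : Vec d) : Prop :=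
  ∀ y, f w + inner ℝ g (y - w) ≤ f y

/-- The joint regret `∑_{t < T} (ℓ_t(w_t) - ℓ_t(u))`. -/
def regret {d : ℕ} (ℓ : ℕ → Vec d → ℝ) (w : ℕ → Vec d) (T : ℕ) (u : Vec d) : ℝ :=
  ∑ t ∈ Finset.range T, (ℓ t (w t) - ℓ t u)

/-- The logarithmic factor `ln (e + ‖u‖ G D T / ν)`. -/
def logFactor (normU G ν : ℝ) (D T : ℕ) : ℝ :=
  Real.log (Real.exp 1 + normU * G * (D : ℝ) * (T : ℝ) / ν)

end

end DOCO

/-! Subgradients reduce the regret to the sum of `⟨g_t, v_t z_t - u⟩`. By `inner_smul_sub_le` each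
term splits into the regret of the scale `v_t` against `‖u‖` on the losses `ĥ_t + ε`, plus `‖u‖`
times the regret of the direction `z_t` against `u / ‖u‖` on the decoded gradients, plus `2 ε ‖u‖`.
The shift by `ε` makes the scale learner pay for the part of the coding error that grows with `v_t`.
The network enters only through `IsDelayed`: a codeword travels one edge per round, so nothing is
missing for `D` rounds.

Direction (`adaDelayDist_regret`): the prediction is compared with dual averaging that sees all past
gradients and the full lag. Missing gradients and the incomplete rate each move the prediction by at
most the missing norm over the root of the known lag; these errors telescope in `√Λ_t`.

Scale (`scale_regret`): for a fixed `η`, the exponential of the negative exponent is a wealth whose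
decrease dominates the round's loss, even though the bet is made with stale information
(`sum_mul_exp_lossExponent_le`). Averaging over `ρ` bounds the cumulative loss by `ν` minus the
mixture wealth, and `mul_sub_wealth_le` shows that this wealth pays for competing with `‖u‖`.

Coding (`delayed_regret`): replacing `‖g_t‖` by `‖g_t‖ + 2 ε` raises the lag by at most `48 ε T G
D`. Under the root, AM-GM turns this into `ε T + G D L`, and `ε` is of order `2^{-b/(dD)} G`. -/

namespace DOCO

/-! ### Propagation of codewords through the graph -/

section Network

variable {V : Type*} (Gr : SimpleGraph V) (I : ℕ → V)

theorem mem_produced {t : ℕ} {n : V} {s : ℕ} : s ∈ produced I t n ↔ s = t ∧ I t = n := by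
  unfold produced
  split_ifs with h <;> simp [h]

theorem mem_incoming {t : ℕ} {σ : V → NodeState} {n : V} {s : ℕ} :
    s ∈ incoming Gr I t σ n ↔ s ≤ t ∧ ∃ m, Gr.Adj n m ∧ s ∈ outgoing Gr I t σ m := by
  simp [incoming]

theorem mem_outgoing {t : ℕ} {σ : V → NodeState} {n : V} {s : ℕ} :
    s ∈ outgoing Gr I t σ n ↔
      (s ∈ (σ n).fresh ∨ (s = t ∧ I t = n)) ∧ t < s + Gr.diam := by
  simp [outgoing, mem_produced]

theorem mem_stored_succ {t : ℕ} {n : V} {s : ℕ} :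
    s ∈ (network Gr I (t + 1) n).stored ↔ s ∈ (network Gr I t n).stored ∨
      (s = t ∧ I t = n) ∨ s ∈ incoming Gr I t (network Gr I t) n := by
  simp [network, mem_produced]

theorem mem_fresh_succ {t : ℕ} {n : V} {s : ℕ} :
    s ∈ (network Gr I (t + 1) n).fresh ↔ s ∈ incoming Gr I t (network Gr I t) n ∧
      s ∉ (network Gr I t n).stored ∧ ¬ (s = t ∧ I t = n) := by
  simp [network, mem_produced]

theorem mem_stored_of_mem_fresh {t : ℕ} {n : V} {s : ℕ}
    (h : s ∈ (network Gr I t n).fresh) : s ∈ (network Gr I t n).stored := by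
  cases t with
  | zero => simp [network] at h
  | succ t =>
    rw [mem_fresh_succ] at h
    rw [mem_stored_succ]
    tauto

/-- A codeword needs at least as many rounds to reach a node as there are edges on the way. -/
theorem dist_le_of_mem_stored (hG : Gr.Connected) {t : ℕ} : ∀ {n : V} {s : ℕ},
    s ∈ (network Gr I t n).stored → s < t ∧ s + Gr.dist (I s) n ≤ t := by
  induction t with
  | zero => intro n s h; simp [network] at h
  | succ t ih =>
    intro n s h
    rw [mem_stored_succ] at h
    rcases h with h | ⟨rfl, h⟩ | h
    · have := ih h; omega
    · simp [h]
    · obtain ⟨hst, m, hadj, hm⟩ := (mem_incoming Gr I).1 h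
      have hd : Gr.dist (I s) n ≤ Gr.dist (I s) m + 1 := by
        have h1 := hG.dist_triangle (u := I s) (v := m) (w := n)
        have h2 := SimpleGraph.dist_eq_one_iff_adj.2 hadj.symm
        omega
      rcases ((mem_outgoing Gr I).1 hm).1 with h | ⟨rfl, h⟩
      · have := ih (mem_stored_of_mem_fresh Gr I h); omega
      · rw [← h, SimpleGraph.dist_self] at hd
        omega

theorem stored_mono {t t' : ℕ} (h : t ≤ t') (n : V) :
    (network Gr I t n).stored ⊆ (network Gr I t' n).stored := by
  induction t', h using Nat.le_induction with
  | base => rfl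
  | succ t' _ ih =>
    intro s hs
    rw [mem_stored_succ]
    exact Or.inl (ih hs)

/-- A codeword is sent out by a node of distance `r` after `r` rounds. -/
theorem mem_outgoing_add_dist (hG : Gr.Connected) (s : ℕ) : ∀ (r : ℕ) (n : V),
    Gr.dist (I s) n = r → r < Gr.diam →
      s ∈ outgoing Gr I (s + r) (network Gr I (s + r)) n := by
  intro r
  induction r with
  | zero =>
    intro n hn hr
    rw [mem_outgoing]
    exact ⟨Or.inr ⟨rfl, hG.dist_eq_zero_iff.1 hn⟩, by omega⟩
  | succ r ih =>
    intro n hn hr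
    -- The first neighbour on a shortest walk from `n` back to `I s` is one step closer.
    obtain ⟨m, hadj, hm⟩ : ∃ m, Gr.Adj n m ∧ Gr.dist (I s) m = r := by
      obtain ⟨p, hp⟩ := hG.exists_walk_length_eq_dist n (I s)
      rw [SimpleGraph.dist_comm, hn] at hp
      cases p with
      | nil => simp at hp
      | @cons _ m _ hadj q =>
        refine ⟨m, hadj, ?_⟩
        simp only [SimpleGraph.Walk.length_cons] at hp
        have h1 := SimpleGraph.dist_le q
        have h2 := hG.dist_triangle (u := I s) (v := m) (w := n)
        have h3 := SimpleGraph.dist_eq_one_iff_adj.2 hadj.symm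
        rw [SimpleGraph.dist_comm] at h1
        omega
    have hout := ih m hm (by omega)
    rw [mem_outgoing]
    refine ⟨Or.inl ?_, by omega⟩
    rw [← add_assoc, mem_fresh_succ, mem_incoming]
    -- The lower bound on travel time shows that `n` could not have held the codeword before, so it
    -- counts as fresh and is forwarded on.
    refine ⟨⟨by omega, m, hadj, hout⟩, fun h => ?_, fun h => ?_⟩
    · have := dist_le_of_mem_stored Gr I hG h; omega
    · obtain rfl : r = 0 := by omega
      have h2 : I s = n := h.2
      rw [h2, SimpleGraph.dist_self] at hn
      omega

theorem mem_stored_of_add_dist_le (hG : Gr.Connected) {s t : ℕ} {n : V} (hst : s < t)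
    (hd : Gr.dist (I s) n ≤ Gr.diam) (h : s + Gr.dist (I s) n ≤ t) :
    s ∈ (network Gr I t n).stored := by
  by_cases h0 : Gr.dist (I s) n = 0
  · refine stored_mono Gr I (show s + 1 ≤ t by omega) n ?_
    rw [mem_stored_succ]
    exact Or.inr (Or.inl ⟨rfl, hG.dist_eq_zero_iff.1 h0⟩)
  · obtain ⟨p, hp⟩ := hG.exists_walk_length_eq_dist n (I s)
    rw [SimpleGraph.dist_comm] at hp
    cases p with
    | nil => simp at h0
    | @cons _ m _ hadj q =>
      simp only [SimpleGraph.Walk.length_cons] at hp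
      have h1 := SimpleGraph.dist_le q
      have h2 := hG.dist_triangle (u := I s) (v := m) (w := n)
      have h3 := SimpleGraph.dist_eq_one_iff_adj.2 hadj.symm
      rw [SimpleGraph.dist_comm] at h1
      refine stored_mono Gr I (show s + Gr.dist (I s) m + 1 ≤ t by omega) n ?_
      rw [mem_stored_succ, mem_incoming]
      -- A node at distance `D` needs only its predecessor at distance `D - 1` to send, and that
      -- happens in round `s + D - 1`, the last one allowed.
      exact Or.inr (Or.inr ⟨by omega, m, hadj,
        mem_outgoing_add_dist Gr I hG s _ m rfl (by omega)⟩)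

theorem avail_subset_range (hG : Gr.Connected) (t : ℕ) : avail Gr I t ⊆ Finset.range t :=
  fun _ hs => Finset.mem_range.2 (dist_le_of_mem_stored Gr I hG hs).1

theorem lt_add_diam_of_notMem_avail [Finite V] (hG : Gr.Connected) {s t : ℕ}
    (hst : s < t) (h : s ∉ avail Gr I t) : t < s + Gr.diam := by
  by_contra! hle
  have := hG.nonempty
  have hd : Gr.dist (I s) (I t) ≤ Gr.diam :=
    SimpleGraph.dist_le_diam (SimpleGraph.connected_iff_ediam_ne_top.1 hG)
  exact h (mem_stored_of_add_dist_le Gr I hG hst hd (by omega))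

/-- The forwarding window confines the stamps sent in round `t` to `t - D < s ≤ t`. -/
theorem card_outgoing_le (hG : Gr.Connected) (t : ℕ) (n : V) :
    (outgoing Gr I t (network Gr I t) n).card ≤ Gr.diam := by
  have hsub : outgoing Gr I t (network Gr I t) n ⊆ Finset.Ico (t + 1 - Gr.diam) (t + 1) := by
    intro s hs
    rw [mem_outgoing] at hs
    have hle : s ≤ t := by
      rcases hs.1 with h | h
      · exact (dist_le_of_mem_stored Gr I hG (mem_stored_of_mem_fresh Gr I h)).1.le
      · exact h.1.le
    rw [Finset.mem_Ico]
    omega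
  have := Finset.card_le_card hsub
  rw [Nat.card_Ico] at this
  omega

theorem bitsSent_le (hG : Gr.Connected) (b t : ℕ) (n : V) :
    bitsSent Gr I (b / Gr.diam) t n ≤ b :=
  (Nat.mul_le_mul_left _ (card_outgoing_le Gr I hG t n)).trans (Nat.div_mul_le_self b _)

end Network

/-! ### Existence of a covering code by volume comparison -/

open MeasureTheory Metric Module in
/-- Any `r`-separated set in the ball of radius `R` has at most `(1 + 2 R / r) ^ dim` elements. -/
theorem card_le_of_separated {E : Type*} [NormedAddCommGroup E] [NormedSpace ℝ E]
    [FiniteDimensional ℝ E] {R r : ℝ} (hR : 0 ≤ R) (hr : 0 < r) (s : Finset E)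
    (hs : ∀ c ∈ s, ‖c‖ ≤ R) (h : ∀ c ∈ s, ∀ d ∈ s, c ≠ d → r ≤ ‖c - d‖) :
    (s.card : ℝ) ≤ (1 + 2 * R / r) ^ finrank ℝ E := by
  borelize E
  let μ : Measure E := Measure.addHaar
  have hδ : 0 < r / 2 := by positivity
  have hρ : 0 < R + r / 2 := by positivity
  have hdisj : Set.Pairwise (s : Set E) (Function.onFun Disjoint fun c => ball c (r / 2)) := by
    rintro c hc d hd hcd
    apply ball_disjoint_ball
    rw [dist_eq_norm]
    linarith [h c hc d hd hcd]
  have hsub : (⋃ c ∈ s, ball c (r / 2)) ⊆ ball (0 : E) (R + r / 2) := by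
    refine Set.iUnion₂_subset fun x hx => ball_subset_ball' ?_
    rw [dist_zero_right]
    linarith [hs x hx]
  have hvol : (s.card : ENNReal) * ENNReal.ofReal ((r / 2) ^ finrank ℝ E) * μ (ball 0 1) ≤
      ENNReal.ofReal ((R + r / 2) ^ finrank ℝ E) * μ (ball 0 1) :=
    calc
      _ = μ (⋃ c ∈ s, ball c (r / 2)) := by
        rw [measure_biUnion_finset hdisj fun c _ => measurableSet_ball]
        simp only [μ.addHaar_ball_of_pos _ hδ]
        simp only [Finset.sum_const, nsmul_eq_mul, mul_assoc]
      _ ≤ μ (ball (0 : E) (R + r / 2)) := measure_mono hsub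
      _ = _ := by simp only [μ.addHaar_ball_of_pos _ hρ]
  have hvol' := (ENNReal.mul_le_mul_iff_left (measure_ball_pos _ _ zero_lt_one).ne'
    measure_ball_lt_top.ne).1 hvol
  have := ENNReal.toReal_le_of_le_ofReal (pow_nonneg hρ.le _) hvol'
  rw [ENNReal.toReal_mul, ENNReal.toReal_natCast, ENNReal.toReal_ofReal (by positivity)] at this
  have h2 : 1 + 2 * R / r = (R + r / 2) / (r / 2) := by field_simp; ring
  rw [h2, div_pow, le_div_iff₀ (by positivity)]
  exact this

/-- A ball of radius `R` is covered by finitely many balls of radius `r`, with the number of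
centres bounded by the packing bound. -/
theorem exists_cover_card_le {E : Type*} [NormedAddCommGroup E] [NormedSpace ℝ E]
    [FiniteDimensional ℝ E] {R r : ℝ} (hR : 0 ≤ R) (hr : 0 < r) :
    ∃ s : Finset E, (s.card : ℝ) ≤ (1 + 2 * R / r) ^ Module.finrank ℝ E ∧
      ∀ x : E, ‖x‖ ≤ R → ∃ c ∈ s, ‖x - c‖ ≤ r := by
  classical
  let P : ℕ → Prop := fun n => ∃ s : Finset E, s.card = n ∧ (∀ c ∈ s, ‖c‖ ≤ R) ∧
    ∀ c ∈ s, ∀ d ∈ s, c ≠ d → r ≤ ‖c - d‖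
  let B : ℕ := ⌊(1 + 2 * R / r) ^ Module.finrank ℝ E⌋₊
  have hP : ∀ n, P n → n ≤ B := by
    rintro n ⟨s, rfl, h1, h2⟩
    exact Nat.le_floor (card_le_of_separated hR hr s h1 h2)
  have hP0 : P 0 := ⟨∅, by simp⟩
  -- A separated set of maximal cardinality is a cover: a point far from all its elements could be
  -- added.
  obtain ⟨s, hcard, h1, h2⟩ := Nat.findGreatest_spec (P := P) (Nat.zero_le B) hP0
  refine ⟨s, card_le_of_separated hR hr s h1 h2, fun x hx => ?_⟩
  by_contra! hfar
  have hxs : x ∉ s := fun hxs => by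
    have := hfar x hxs
    simp only [sub_self, norm_zero] at this
    linarith
  have hP1 : P (s.card + 1) := by
    refine ⟨insert x s, Finset.card_insert_of_notMem hxs, ?_, ?_⟩
    · simpa [hx] using h1
    · intro c hc d hd hcd
      rw [Finset.mem_insert] at hc hd
      rcases hc with rfl | hc <;> rcases hd with rfl | hd
      · exact absurd rfl hcd
      · exact (hfar d hd).le
      · rw [norm_sub_rev]; exact (hfar c hc).le
      · exact h2 c hc d hd hcd
  have := Nat.le_findGreatest (hP _ hP1) hP1
  omega

theorem nonempty_coverCode {d : ℕ} (hd : 0 < d) (k : ℕ) {G : ℝ} (hG : 0 < G) :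
    Nonempty (CoverCode d k G) := by
  classical
  set δ : ℝ := (2 : ℝ) ^ (-((k : ℝ) / (d : ℝ))) with hδ
  have hδ0 : 0 < δ := by positivity
  have hr : 0 < coverRadius d k G := by unfold coverRadius; positivity
  obtain ⟨s, hcard, hs⟩ : ∃ s : Finset (Vec d), s.card ≤ 2 ^ k ∧
      ∀ x : Vec d, ‖x‖ ≤ G → ∃ c ∈ s, ‖x - c‖ ≤ coverRadius d k G := by
    -- With radius `3 δ G` the packing bound is `(1 + 2 / (3 δ)) ^ d`, which is at most `δ⁻¹ ^ d = 2
    -- ^ k` exactly when `δ ≤ 1 / 3`. Otherwise the radius exceeds `G` and the single centre `0`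
    -- suffices.
    by_cases h : δ ≤ 1 / 3
    · obtain ⟨s, h1, h2⟩ := exists_cover_card_le (E := Vec d) hG.le hr
      refine ⟨s, ?_, h2⟩
      have h3 : 1 + 2 * G / coverRadius d k G ≤ δ⁻¹ := by
        have : 1 + 2 * G / coverRadius d k G = (3 * δ + 2) / (3 * δ) := by
          unfold coverRadius
          rw [← hδ]
          field_simp
        rw [this, div_le_iff₀ (by positivity), inv_mul_eq_div, le_div_iff₀ hδ0]
        nlinarith
      have h4 : (δ⁻¹) ^ d = (2 : ℝ) ^ k := by
        rw [hδ, ← Real.rpow_neg (by norm_num), neg_neg, ← Real.rpow_natCast,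
          ← Real.rpow_mul (by norm_num), div_mul_cancel₀ _ (by positivity), Real.rpow_natCast]
      have h5 : (s.card : ℝ) ≤ (2 : ℝ) ^ k := by
        rw [← h4]
        refine h1.trans ?_
        rw [finrank_euclideanSpace_fin]
        exact pow_le_pow_left₀ (by positivity) h3 d
      exact_mod_cast h5
    · push Not at h
      refine ⟨{0}, by simpa using Nat.one_le_two_pow, fun x hx => ⟨0, by simp, ?_⟩⟩
      rw [sub_zero]
      refine hx.trans ?_
      unfold coverRadius
      rw [← hδ]
      nlinarith
  have hne : s.Nonempty := by
    obtain ⟨c, hc, -⟩ := hs 0 (by simpa using hG.le)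
    exact ⟨c, hc⟩
  have : Nonempty s := hne.to_subtype
  obtain ⟨f⟩ : Nonempty (s ↪ (Fin k → Bool)) :=
    Function.Embedding.nonempty_of_card_le (by simpa using hcard)
  choose! p hps hp using hs
  refine ⟨⟨fun i => (Function.invFun f i : s), fun x => if h : ‖x‖ ≤ G then f ⟨p x, hps x h⟩
    else fun _ => false, fun x hx => ?_⟩⟩
  simp only [hx, dif_pos, Function.leftInverse_invFun f.injective _]
  exact hp x hx

/-! ### The lag under delayed feedback -/

open Finset

/-- The pairwise lag of the numbers `x s` among the time stamps in `A`. -/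
noncomputable def pairLag (γ : ℕ → Finset ℕ) (x : ℕ → ℝ) (A : Finset ℕ) : ℝ :=
  ∑ s ∈ A, (x s ^ 2 + 2 * x s * ∑ i ∈ γ s ∩ A, x i)

/-- Delayed feedback: in round `t` the time stamps `S t` are available, the past time stamps `γ t`
are missing, and nothing is missing for `D` rounds or more. -/
structure IsDelayed (D : ℕ) (S γ : ℕ → Finset ℕ) : Prop where
  subset_range : ∀ t, S t ⊆ range t
  missing_eq : ∀ t, γ t = range t \ S t
  lt_add_of_mem : ∀ t, ∀ s ∈ γ t, t < s + D

section

variable {D : ℕ} {S γ : ℕ → Finset ℕ}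

theorem IsDelayed.missing_subset (h : IsDelayed D S γ) (t : ℕ) : γ t ⊆ range t := by
  rw [h.missing_eq]; exact sdiff_subset

theorem IsDelayed.card_missing_le (h : IsDelayed D S γ) (t : ℕ) : (γ t).card ≤ D := by
  have hsub : γ t ⊆ Ico (t - D) t := by
    intro s hs
    have h1 := h.lt_add_of_mem t s hs
    have h2 := mem_range.1 (h.missing_subset t hs)
    rw [mem_Ico]; omega
  have := card_le_card hsub
  rw [Nat.card_Ico] at this
  omega

theorem IsDelayed.sum_eq_add (h : IsDelayed D S γ) {E : Type*} [AddCommMonoid E] (f : ℕ → E)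
    (t : ℕ) : ∑ s ∈ range t, f s = ∑ s ∈ S t, f s + ∑ s ∈ γ t, f s := by
  rw [h.missing_eq, add_comm, sum_sdiff (h.subset_range t)]

theorem IsDelayed.sum_missing_le (h : IsDelayed D S γ) {x : ℕ → ℝ} {M : ℝ} (hM : 0 ≤ M) {t : ℕ}
    (hx : ∀ s < t, x s ≤ M) : ∑ s ∈ γ t, x s ≤ D * M := by
  calc ∑ s ∈ γ t, x s ≤ (γ t).card • M :=
        sum_le_card_nsmul _ _ _ fun s hs => hx s (mem_range.1 (h.missing_subset t hs))
    _ ≤ D * M := by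
        rw [nsmul_eq_mul]
        gcongr
        exact h.card_missing_le t

theorem IsDelayed.pairLag_range (h : IsDelayed D S γ) (x : ℕ → ℝ) (t : ℕ) :
    pairLag γ x (range t) = ∑ s ∈ range t, (x s ^ 2 + 2 * x s * ∑ i ∈ γ s, x i) := by
  refine sum_congr rfl fun s hs => ?_
  rw [inter_eq_left.2 ((h.missing_subset s).trans (range_mono (mem_range.1 hs).le))]

theorem IsDelayed.pairLag_range_succ (h : IsDelayed D S γ) (x : ℕ → ℝ) (t : ℕ) :
    pairLag γ x (range (t + 1)) =
      pairLag γ x (range t) + (x t ^ 2 + 2 * x t * ∑ i ∈ γ t, x i) := by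
  rw [h.pairLag_range, h.pairLag_range, sum_range_succ]

/-- Sort the pairs `(s, i)` with `i ∈ γ s` by availability in round `t`: both available, `s`
missing, or only `i` missing. The last kind is regrouped by `i`, so that every unknown contribution
carries a factor `x` at a missing stamp. -/
theorem IsDelayed.pairLag_split (h : IsDelayed D S γ) (x : ℕ → ℝ) (t : ℕ) :
    pairLag γ x (range t) = pairLag γ x (S t) +
      ∑ s ∈ γ t, (x s ^ 2 + 2 * x s * ∑ i ∈ γ s, x i) +
      ∑ i ∈ γ t, 2 * x i * ∑ s ∈ (S t).filter (fun s => i ∈ γ s), x s := by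
  rw [h.pairLag_range, h.sum_eq_add]
  have key : ∑ s ∈ S t, (x s ^ 2 + 2 * x s * ∑ i ∈ γ s, x i) = pairLag γ x (S t) +
      ∑ s ∈ S t, 2 * x s * ∑ i ∈ γ s \ S t, x i := by
    unfold pairLag
    rw [← sum_add_distrib]
    refine sum_congr rfl fun s _ => ?_
    rw [← sum_inter_add_sum_sdiff (γ s) (S t)]
    ring
  have swap : ∑ s ∈ S t, 2 * x s * ∑ i ∈ γ s \ S t, x i =
      ∑ i ∈ γ t, 2 * x i * ∑ s ∈ (S t).filter (fun s => i ∈ γ s), x s := by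
    simp only [mul_sum]
    rw [sum_comm' (s' := fun i => (S t).filter (fun s => i ∈ γ s)) (t' := γ t)]
    · refine sum_congr rfl fun i _ => sum_congr rfl fun s _ => by ring
    · intro s i
      rw [h.missing_eq t]
      simp only [mem_sdiff, mem_filter, mem_range]
      constructor
      · rintro ⟨hs, hi, hiS⟩
        have h1 := mem_range.1 (h.missing_subset s hi)
        have h2 := mem_range.1 (h.subset_range t hs)
        exact ⟨⟨hs, hi⟩, by omega, hiS⟩
      · rintro ⟨⟨hs, hi⟩, -, hiS⟩
        exact ⟨hs, hi, hiS⟩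
  rw [key, swap]
  ring

theorem pairLag_nonneg {x : ℕ → ℝ} (hx : ∀ s, 0 ≤ x s) (A : Finset ℕ) : 0 ≤ pairLag γ x A :=
  sum_nonneg fun s _ => add_nonneg (sq_nonneg _)
    (mul_nonneg (mul_nonneg (by norm_num) (hx s)) (sum_nonneg fun i _ => hx i))

theorem IsDelayed.pairLag_le (h : IsDelayed D S γ) {x : ℕ → ℝ} (hx : ∀ s, 0 ≤ x s) (t : ℕ) :
    pairLag γ x (S t) ≤ pairLag γ x (range t) := by
  rw [h.pairLag_split]
  have h1 : 0 ≤ ∑ s ∈ γ t, (x s ^ 2 + 2 * x s * ∑ i ∈ γ s, x i) :=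
    sum_nonneg fun s _ => add_nonneg (sq_nonneg _)
      (mul_nonneg (mul_nonneg (by norm_num) (hx s)) (sum_nonneg fun i _ => hx i))
  have h2 : 0 ≤ ∑ i ∈ γ t, 2 * x i * ∑ s ∈ (S t).filter (fun s => i ∈ γ s), x s :=
    sum_nonneg fun s _ => mul_nonneg (mul_nonneg (by norm_num) (hx s)) (sum_nonneg fun i _ => hx i)
  linarith

/-- The part of the lag that is unknown in round `t` is controlled by the missing terms. -/
theorem IsDelayed.pairLag_sub_le (h : IsDelayed D S γ) (hD : 1 ≤ D) {x : ℕ → ℝ}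
    (hx : ∀ s, 0 ≤ x s) {M : ℝ} (hM : 0 ≤ M) {t : ℕ} (hxM : ∀ s < t, x s ≤ M) :
    pairLag γ x (range t) - pairLag γ x (S t) ≤ 5 * D * M * ∑ s ∈ γ t, x s := by
  have hD' : (1 : ℝ) ≤ D := by exact_mod_cast hD
  rw [h.pairLag_split]
  have hlt : ∀ s ∈ γ t, s < t := fun s hs => mem_range.1 (h.missing_subset t hs)
  -- Per missing stamp this costs `M + 2 D M ≤ 3 D M`; the reverse pairs in `h2` cost `2 D M`,
  -- whence the `5`.
  have h1 : ∑ s ∈ γ t, (x s ^ 2 + 2 * x s * ∑ i ∈ γ s, x i) ≤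
      ∑ s ∈ γ t, (3 * D * M) * x s := by
    refine sum_le_sum fun s hs => ?_
    have ha := h.sum_missing_le hM (t := s) fun i hi => hxM i (hi.trans (hlt s hs))
    have hb := hxM s (hlt s hs)
    have hc := mul_le_mul_of_nonneg_left ha (hx s)
    have hd := mul_le_mul_of_nonneg_left hb (hx s)
    have he := mul_le_mul_of_nonneg_left hD' (mul_nonneg (hx s) hM)
    nlinarith
  have h2 : ∑ i ∈ γ t, 2 * x i * ∑ s ∈ (S t).filter (fun s => i ∈ γ s), x s ≤
      ∑ i ∈ γ t, (2 * D * M) * x i := by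
    refine sum_le_sum fun i hi => ?_
    have hcard : ((S t).filter (fun s => i ∈ γ s)).card ≤ D := by
      -- A gradient can be missing only in the `D` rounds that start with its own.
      have hsub : (S t).filter (fun s => i ∈ γ s) ⊆ Ico i (i + D) := by
        intro s hs
        rw [mem_filter] at hs
        have ha := h.lt_add_of_mem s i hs.2
        have hb := mem_range.1 (h.missing_subset s hs.2)
        rw [mem_Ico]; omega
      simpa using card_le_card hsub
    have ha : ∑ s ∈ (S t).filter (fun s => i ∈ γ s), x s ≤ D * M := by
      calc _ ≤ ((S t).filter (fun s => i ∈ γ s)).card • M :=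
            sum_le_card_nsmul _ _ _ fun s hs =>
              hxM s (mem_range.1 (h.subset_range t (mem_filter.1 hs).1))
        _ ≤ D * M := by
            rw [nsmul_eq_mul]
            gcongr
    have hc := mul_le_mul_of_nonneg_left ha (hx i)
    linarith
  rw [← mul_sum] at h1 h2
  linarith

theorem IsDelayed.pairLag_range_le (h : IsDelayed D S γ) {x : ℕ → ℝ} (hx : ∀ s, 0 ≤ x s)
    {M : ℝ} (hM : 0 ≤ M) {T : ℕ} (hxM : ∀ s < T, x s ≤ M) :
    pairLag γ x (range T) ≤ T * (M ^ 2 * (1 + 2 * D)) := by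
  rw [h.pairLag_range]
  have : ∀ s ∈ range T, x s ^ 2 + 2 * x s * ∑ i ∈ γ s, x i ≤ M ^ 2 * (1 + 2 * D) := by
    intro s hs
    have hs' := mem_range.1 hs
    have ha := h.sum_missing_le hM (t := s) fun i hi => hxM i (hi.trans hs')
    have hb := hxM s hs'
    have hc : x s * ∑ i ∈ γ s, x i ≤ M * (D * M) :=
      mul_le_mul hb ha (sum_nonneg fun i _ => hx i) hM
    have hd := pow_le_pow_left₀ (hx s) hb 2
    linarith
  calc _ ≤ ∑ s ∈ range T, M ^ 2 * (1 + 2 * (D : ℝ)) := sum_le_sum this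
    _ = _ := by rw [sum_const, card_range, nsmul_eq_mul]

theorem pairLag_mono {x y : ℕ → ℝ} (hx : ∀ s, 0 ≤ x s) {T : ℕ}
    (hxy : ∀ s < T, x s ≤ y s) : pairLag γ x (range T) ≤ pairLag γ y (range T) := by
  refine sum_le_sum fun s hs => ?_
  have hs' := mem_range.1 hs
  have h1 := hxy s hs'
  have h0 := hx s
  have h2 : ∑ i ∈ γ s ∩ range T, x i ≤ ∑ i ∈ γ s ∩ range T, y i :=
    sum_le_sum fun i hi => hxy i (mem_range.1 (mem_inter.1 hi).2)
  have h3 : 0 ≤ ∑ i ∈ γ s ∩ range T, x i := sum_nonneg fun i _ => hx i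
  have h4 := mul_le_mul h1 h2 h3 (h0.trans h1)
  have h5 := pow_le_pow_left₀ h0 h1 2
  linarith

end

/-- The interface to the learning part: from here on the graph matters only through the delay bound.
-/
theorem isDelayed_network {V : Type*} [Finite V] {Gr : SimpleGraph V} (hG : Gr.Connected)
    (I : ℕ → V) : IsDelayed Gr.diam (avail Gr I) (missing Gr I) where
  subset_range := avail_subset_range Gr I hG
  missing_eq _ := rfl
  lt_add_of_mem t s hs := by
    rw [missing, mem_sdiff, mem_range] at hs
    exact lt_add_diam_of_notMem_avail Gr I hG hs.1 hs.2

/-! ### The direction: dual averaging on the unit ball and its delayed version -/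

section Projection

variable {d : ℕ}

theorem norm_projUnitBall_le (y : Vec d) : ‖projUnitBall y‖ ≤ 1 := by
  have h : 0 < max 1 ‖y‖ := lt_max_of_lt_left one_pos
  rw [projUnitBall, norm_smul, norm_inv, Real.norm_of_nonneg h.le, inv_mul_le_iff₀ h, mul_one]
  exact le_max_right _ _

theorem inner_sub_projUnitBall_le (y : Vec d) {w : Vec d} (hw : ‖w‖ ≤ 1) :
    inner ℝ (y - projUnitBall y) (w - projUnitBall y) ≤ 0 := by
  by_cases hy : ‖y‖ ≤ 1
  · simp [projUnitBall, max_eq_left hy]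
  · push Not at hy
    have h0 : 0 < ‖y‖ := by linarith
    set p := projUnitBall y with hp
    have hpy : p = ‖y‖⁻¹ • y := by rw [hp, projUnitBall, max_eq_right hy.le]
    have hyp : y = ‖y‖ • p := by rw [hpy, smul_smul, mul_inv_cancel₀ h0.ne', one_smul]
    have hp1 : ‖p‖ = 1 := by
      rw [hpy, norm_smul, norm_inv, norm_norm, inv_mul_cancel₀ h0.ne']
    have h1 : y - p = (‖y‖ - 1) • p := by
      rw [sub_smul, one_smul, ← hyp]
    rw [h1, real_inner_smul_left, inner_sub_right, real_inner_self_eq_norm_sq, hp1]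
    have h2 := real_inner_le_norm p w
    rw [hp1, one_mul] at h2
    nlinarith

/-- Adding the variational inequalities at the two projections gives firm nonexpansiveness;
Cauchy-Schwarz finishes. -/
theorem norm_projUnitBall_sub_le (y y' : Vec d) :
    ‖projUnitBall y - projUnitBall y'‖ ≤ ‖y - y'‖ := by
  have h1 := inner_sub_projUnitBall_le y (norm_projUnitBall_le y')
  have h2 := inner_sub_projUnitBall_le y' (norm_projUnitBall_le y)
  set p := projUnitBall y
  set p' := projUnitBall y'
  have h3 : ‖p - p'‖ ^ 2 ≤ inner ℝ (y - y') (p - p') := by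
    rw [← real_inner_self_eq_norm_sq]
    simp only [inner_sub_left, inner_sub_right] at h1 h2 ⊢
    linarith
  have h4 := real_inner_le_norm (y - y') (p - p')
  by_contra! h
  nlinarith [norm_nonneg (y - y'), norm_nonneg (p - p')]

/-- In this form, predictions at two rates from the same sum `θ` are collinear, so their distance is
a difference of scalars times `‖θ‖`. -/
theorem projUnitBall_neg_inv_smul {R : ℝ} (hR : 0 < R) (θ : Vec d) :
    projUnitBall (-(R⁻¹ • θ)) = -((max R ‖θ‖)⁻¹ • θ) := by
  have h : max R ‖θ‖ = R * max 1 ‖R⁻¹ • θ‖ := by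
    rw [norm_smul, norm_inv, Real.norm_of_nonneg hR.le, mul_max_of_nonneg _ _ hR.le, mul_one,
      mul_inv_cancel_left₀ hR.ne']
  rw [projUnitBall, norm_neg, smul_neg, smul_smul, h, mul_inv, mul_comm]

/-- Changing the learning rate moves the prediction by at most the relative change. -/
theorem norm_projUnitBall_rate_sub_le {R R' : ℝ} (hR : 0 < R) (hRR' : R ≤ R') (θ : Vec d) :
    ‖projUnitBall (-(R⁻¹ • θ)) - projUnitBall (-(R'⁻¹ • θ))‖ ≤ (R' - R) / R := by
  rw [projUnitBall_neg_inv_smul hR, projUnitBall_neg_inv_smul (hR.trans_le hRR'), neg_sub_neg,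
    ← sub_smul, norm_smul, Real.norm_eq_abs, abs_sub_comm]
  set A := max R ‖θ‖
  set B := max R' ‖θ‖
  have hRA : R ≤ A := le_max_left _ _
  have hA : 0 < A := hR.trans_le hRA
  have hAB : A ≤ B := max_le_max_right _ hRR'
  have hB : 0 < B := hA.trans_le hAB
  have hnB : ‖θ‖ ≤ B := le_max_right _ _
  have hBA : B - A ≤ R' - R := by
    have : B ≤ (R' - R) + A := by
      refine max_le ?_ ?_
      · linarith
      · linarith [le_max_right R ‖θ‖]
    linarith
  rw [abs_of_nonneg (sub_nonneg.2 (inv_anti₀ hA hAB))]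
  have h1 : (A⁻¹ - B⁻¹) * ‖θ‖ = (B - A) / A * (‖θ‖ / B) := by field_simp
  rw [h1]
  calc (B - A) / A * (‖θ‖ / B) ≤ (R' - R) / R * 1 := by
        have h2 : (B - A) / A ≤ (R' - R) / R :=
          div_le_div₀ (by linarith) hBA hR hRA
        exact mul_le_mul h2 ((div_le_one hB).2 hnB) (by positivity)
          (div_nonneg (by linarith) hR.le)
    _ = _ := mul_one _

/-- The prediction of dual averaging minimises the regularised linear loss, with the quadratic
growth given by strong convexity. -/
theorem dualAveraging_growth {R : ℝ} (hR : 0 < R) (θ : Vec d) {w : Vec d} (hw : ‖w‖ ≤ 1) :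
    inner ℝ θ (projUnitBall (-(R⁻¹ • θ))) + R / 2 * ‖projUnitBall (-(R⁻¹ • θ))‖ ^ 2 +
      R / 2 * ‖w - projUnitBall (-(R⁻¹ • θ))‖ ^ 2 ≤ inner ℝ θ w + R / 2 * ‖w‖ ^ 2 := by
  have h := inner_sub_projUnitBall_le (-(R⁻¹ • θ)) hw
  set p := projUnitBall (-(R⁻¹ • θ))
  have h' := mul_nonpos_of_nonneg_of_nonpos hR.le h
  have e1 : R * inner ℝ (-(R⁻¹ • θ) - p) (w - p) =
      -(inner ℝ θ w - inner ℝ θ p) - R * (inner ℝ p w - ‖p‖ ^ 2) := by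
    rw [inner_sub_left, inner_neg_left, real_inner_smul_left, inner_sub_right, inner_sub_right,
      real_inner_self_eq_norm_sq]
    field_simp
  rw [e1] at h'
  rw [norm_sub_sq_real, real_inner_comm p w]
  linarith

/-- Regret of dual averaging on the unit ball with a monotone sequence of rates `1 / R t`. -/
theorem dualAveraging_regret {R : ℕ → ℝ} (hR : ∀ t, 0 < R t) (hmono : ∀ t, R t ≤ R (t + 1))
    (x : ℕ → Vec d) (T : ℕ) {u : Vec d} (hu : ‖u‖ ≤ 1) :
    ∑ t ∈ range T,
        inner ℝ (x t) (projUnitBall (-((R t)⁻¹ • ∑ s ∈ range t, x s)) - u) ≤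
      R T / 2 + ∑ t ∈ range T, ‖x t‖ ^ 2 / (2 * R t) := by
  set z : ℕ → Vec d := fun t => projUnitBall (-((R t)⁻¹ • ∑ s ∈ range t, x s)) with hz
  have hz1 : ∀ t, ‖z t‖ ≤ 1 := fun t => norm_projUnitBall_le _
  -- The potential is the minimal regularised cumulative loss. Moving from `z n` to `z (n + 1)`
  -- gains a quadratic growth term, which absorbs the stability error by completing the square.
  have key : ∀ n, ∑ t ∈ range n, inner ℝ (x t) (z t) ≤
      inner ℝ (∑ s ∈ range n, x s) (z n) + R n / 2 * ‖z n‖ ^ 2 +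
        ∑ t ∈ range n, ‖x t‖ ^ 2 / (2 * R t) := by
    intro n
    induction n with
    | zero =>
      have := (hR 0).le
      simp only [range_zero, sum_empty, inner_zero_left, zero_add, add_zero]
      positivity
    | succ n ih =>
      have h1 : inner ℝ (∑ s ∈ range n, x s) (z n) + R n / 2 * ‖z n‖ ^ 2 +
          R n / 2 * ‖z (n + 1) - z n‖ ^ 2 ≤
          inner ℝ (∑ s ∈ range n, x s) (z (n + 1)) + R n / 2 * ‖z (n + 1)‖ ^ 2 :=
        dualAveraging_growth (hR n) (∑ s ∈ range n, x s) (hz1 (n + 1))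
      have h2 : R n / 2 * ‖z (n + 1)‖ ^ 2 ≤ R (n + 1) / 2 * ‖z (n + 1)‖ ^ 2 := by
        have := hmono n
        gcongr
      have h3 : inner ℝ (x n) (z n) - inner ℝ (x n) (z (n + 1)) ≤
          ‖x n‖ ^ 2 / (2 * R n) + R n / 2 * ‖z (n + 1) - z n‖ ^ 2 := by
        rw [← inner_sub_right]
        have h4 := real_inner_le_norm (x n) (z n - z (n + 1))
        rw [norm_sub_rev] at h4
        have h5 : ‖x n‖ ^ 2 / (2 * R n) + R n / 2 * ‖z (n + 1) - z n‖ ^ 2 -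
            ‖x n‖ * ‖z (n + 1) - z n‖ = (‖x n‖ - R n * ‖z (n + 1) - z n‖) ^ 2 / (2 * R n) := by
          have := (hR n).ne'
          field_simp
          ring
        have h6 : 0 ≤ (‖x n‖ - R n * ‖z (n + 1) - z n‖) ^ 2 / (2 * R n) := by
          have := (hR n).le
          positivity
        linarith
      rw [sum_range_succ, sum_range_succ, sum_range_succ, inner_add_left]
      linarith
  have h1 : inner ℝ (∑ s ∈ range T, x s) (z T) + R T / 2 * ‖z T‖ ^ 2 +
      R T / 2 * ‖u - z T‖ ^ 2 ≤ inner ℝ (∑ s ∈ range T, x s) u + R T / 2 * ‖u‖ ^ 2 :=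
    dualAveraging_growth (hR T) (∑ s ∈ range T, x s) hu
  have h2 : R T / 2 * ‖u‖ ^ 2 ≤ R T / 2 * 1 := by
    have := (hR T).le
    gcongr
    exact pow_le_one₀ (norm_nonneg _) hu
  have h3 : 0 ≤ R T / 2 * ‖u - z T‖ ^ 2 := by
    have := (hR T).le
    positivity
  have h4 : ∑ t ∈ range T, inner ℝ (x t) (z t - u) =
      ∑ t ∈ range T, inner ℝ (x t) (z t) - inner ℝ (∑ s ∈ range T, x s) u := by
    rw [sum_inner, ← sum_sub_distrib]
    exact sum_congr rfl fun t _ => inner_sub_right _ _ _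
  rw [h4]
  linarith [key T]

end Projection

/-- Factor `B - A = (√B - √A) (√B + √A)`; the second factor is at most `2 r`. -/
theorem sub_div_le_two_mul_sqrt_sub {A B r : ℝ} (hA : 0 ≤ A) (hAB : A ≤ B) (hr : 0 < r)
    (h : √B ≤ r) : (B - A) / r ≤ 2 * (√B - √A) := by
  rw [div_le_iff₀ hr]
  have h1 := Real.sq_sqrt hA
  have h2 := Real.sq_sqrt (hA.trans hAB)
  have h3 := Real.sqrt_le_sqrt hAB
  have h4 := Real.sqrt_nonneg A
  nlinarith

/-- Regret of AdaDelay-Dist against the unit ball. -/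
theorem adaDelayDist_regret {d D : ℕ} {S γ : ℕ → Finset ℕ} (h : IsDelayed D S γ) (hD : 1 ≤ D)
    {M : ℝ} (hM : 0 < M) {x : ℕ → Vec d} {T : ℕ} (hx : ∀ s < T, ‖x s‖ ≤ M) {u : Vec d}
    (hu : ‖u‖ ≤ 1) :
    ∑ t ∈ range T, inner ℝ (x t) (adaDelayDist D M S γ x t - u) ≤
      4 * √(pairLag γ (fun s => ‖x s‖) (range T)) + 2 * D * M := by
  have hD' : (1 : ℝ) ≤ D := by exact_mod_cast hD
  have hDM : 0 < D * M := by positivity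
  have hDMM : M ≤ D * M := by nlinarith
  have hn : ∀ s, 0 ≤ ‖x s‖ := fun s => norm_nonneg _
  set Λ : ℕ → ℝ := fun t => pairLag γ (fun s => ‖x s‖) (range t) with hΛ
  set Γ : ℕ → ℝ := fun t => pairLag γ (fun s => ‖x s‖) (S t) with hΓ
  set c : ℝ := 8 * (D : ℝ) ^ 2 * M ^ 2 with hc
  have hcDM : c = 8 * (D * M) ^ 2 := by rw [hc]; ring
  have hc0 : 0 < c := by positivity
  have hΛ0 : ∀ t, 0 ≤ Λ t := fun t => pairLag_nonneg hn _
  have hΓ0 : ∀ t, 0 ≤ Γ t := fun t => pairLag_nonneg hn _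
  have hΓΛ : ∀ t, Γ t ≤ Λ t := fun t => h.pairLag_le hn t
  have hΛmono : ∀ t, Λ t ≤ Λ (t + 1) := by
    intro t
    have := h.pairLag_range_succ (fun s => ‖x s‖) t
    have h2 : 0 ≤ ‖x t‖ ^ 2 + 2 * ‖x t‖ * ∑ i ∈ γ t, ‖x i‖ := by positivity
    simp only [hΛ]
    linarith
  set R : ℕ → ℝ := fun t => √(c + Λ t) with hR
  set r : ℕ → ℝ := fun t => √(c + Γ t) with hr
  have hr0 : ∀ t, 0 < r t := fun t => Real.sqrt_pos.2 (by linarith [hΓ0 t])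
  have hrR : ∀ t, r t ≤ R t := fun t => Real.sqrt_le_sqrt (by linarith [hΓΛ t])
  have hR0 : ∀ t, 0 < R t := fun t => (hr0 t).trans_le (hrR t)
  have hRmono : ∀ t, R t ≤ R (t + 1) := fun t => Real.sqrt_le_sqrt (by linarith [hΛmono t])
  set zbar : ℕ → Vec d := fun t => projUnitBall (-((R t)⁻¹ • ∑ s ∈ range t, x s)) with hzbar
  -- The stability term of undelayed dual averaging is put on the left, so that on summation it
  -- cancels the same term in `dualAveraging_regret`.
  have hstep : ∀ t ∈ range T, inner ℝ (x t) (adaDelayDist D M S γ x t - u) +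
      ‖x t‖ ^ 2 / (2 * R t) ≤ inner ℝ (x t) (zbar t - u) + 3 * (√(Λ (t + 1)) - √(Λ t)) := by
    intro t ht
    have ht' := mem_range.1 ht
    set y := ∑ i ∈ γ t, ‖x i‖ with hy
    have hy0 : 0 ≤ y := sum_nonneg fun i _ => hn i
    have hyDM : y ≤ D * M := h.sum_missing_le hM.le fun s hs => hx s (hs.trans ht')
    have hsucc : Λ (t + 1) - Λ t = ‖x t‖ ^ 2 + 2 * ‖x t‖ * y := by
      have := h.pairLag_range_succ (fun s => ‖x s‖) t
      simp only [hΛ, hy]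
      linarith
    have hgap : Λ t - Γ t ≤ 5 * D * M * y :=
      h.pairLag_sub_le hD hn hM.le fun s hs => hx s (hs.trans ht')
    have hxt := hx t ht'
    -- This fixes the `8` in the rate: the unknown lag is at most `5 (D M)²` and the current round
    -- adds at most `3 (D M)²`.
    have hq : Λ (t + 1) ≤ c + Γ t := by
      have h1 : ‖x t‖ ^ 2 ≤ (D * M) ^ 2 := pow_le_pow_left₀ (hn t) (hxt.trans hDMM) 2
      have h2 : ‖x t‖ * y ≤ (D * M) * (D * M) :=
        mul_le_mul (hxt.trans hDMM) hyDM hy0 hDM.le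
      have h3 : (D * M) * y ≤ (D * M) * (D * M) := mul_le_mul_of_nonneg_left hyDM hDM.le
      rw [hcDM]
      linarith
    have hsr : √(Λ (t + 1)) ≤ r t := Real.sqrt_le_sqrt hq
    have hpot := sub_div_le_two_mul_sqrt_sub (hΛ0 t) (hΛmono t) (hr0 t) hsr
    rw [hsucc] at hpot
    set z₁ : Vec d := projUnitBall (-((r t)⁻¹ • ∑ s ∈ range t, x s)) with hz₁
    -- The intermediate point `z₁` uses all past gradients but the algorithm's own rate: `hd1` is
    -- the effect of the missing gradients, `hd2` that of the missing lag.
    have hd1 : ‖adaDelayDist D M S γ x t - z₁‖ ≤ y / r t := by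
      refine (norm_projUnitBall_sub_le _ _).trans ?_
      have e1 : -(adaRate D M S γ x t • ∑ s ∈ S t, x s) - -((r t)⁻¹ • ∑ s ∈ range t, x s) =
          (r t)⁻¹ • ∑ s ∈ γ t, x s := by
        rw [h.sum_eq_add x t]
        have : adaRate D M S γ x t = (r t)⁻¹ := rfl
        rw [this, smul_add]
        abel
      rw [e1, norm_smul, norm_inv, Real.norm_of_nonneg (hr0 t).le, inv_mul_eq_div]
      exact div_le_div_of_nonneg_right (norm_sum_le _ _) (hr0 t).le
    have hd2 : ‖z₁ - zbar t‖ ≤ y / r t := by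
      refine (norm_projUnitBall_rate_sub_le (hr0 t) (hrR t) _).trans ?_
      refine div_le_div_of_nonneg_right ?_ (hr0 t).le
      have h1 : R t ^ 2 = c + Λ t := Real.sq_sqrt (by linarith [hΛ0 t])
      have h2 : r t ^ 2 = c + Γ t := Real.sq_sqrt (by linarith [hΓ0 t])
      -- Then `R + r ≥ 5 D M`, and `R² - r² ≤ 5 D M y` gives `R - r ≤ y`.
      have h3 : 5 / 2 * (D * M) ≤ r t := by
        refine Real.le_sqrt_of_sq_le ?_
        rw [hcDM]
        nlinarith [hΓ0 t]
      have h4 : (R t - r t) * (R t + r t) ≤ 5 * (D * M) * y := by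
        calc (R t - r t) * (R t + r t) = R t ^ 2 - r t ^ 2 := by ring
          _ ≤ _ := by rw [h1, h2]; linarith
      have h5 : (R t - r t) * (5 * (D * M)) ≤ (R t - r t) * (R t + r t) :=
        mul_le_mul_of_nonneg_left (by linarith [hrR t]) (by linarith [hrR t])
      have h6 : (5 * (D * M)) * (R t - r t) ≤ (5 * (D * M)) * y := by linarith
      exact le_of_mul_le_mul_left h6 (by positivity)
    have hin : inner ℝ (x t) (adaDelayDist D M S γ x t - zbar t) ≤ 2 * ‖x t‖ * y / r t := by
      refine (real_inner_le_norm _ _).trans ?_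
      have h1 : ‖adaDelayDist D M S γ x t - zbar t‖ ≤ y / r t + y / r t := by
        have := norm_add_le (adaDelayDist D M S γ x t - z₁) (z₁ - zbar t)
        rw [sub_add_sub_cancel] at this
        linarith
      calc _ ≤ ‖x t‖ * (y / r t + y / r t) := mul_le_mul_of_nonneg_left h1 (hn t)
        _ = _ := by ring
    have hsplit : inner ℝ (x t) (adaDelayDist D M S γ x t - u) =
        inner ℝ (x t) (adaDelayDist D M S γ x t - zbar t) + inner ℝ (x t) (zbar t - u) := by
      rw [← inner_add_right, sub_add_sub_cancel]
    have hsq : ‖x t‖ ^ 2 / (2 * R t) ≤ ‖x t‖ ^ 2 / r t :=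
      div_le_div_of_nonneg_left (by positivity) (hr0 t) (by linarith [hrR t, hR0 t])
    have hmonoΛ := Real.sqrt_le_sqrt (hΛmono t)
    rw [add_div] at hpot
    rw [hsplit]
    linarith
  have hsum := sum_le_sum hstep
  rw [sum_add_distrib, sum_add_distrib, ← mul_sum, sum_range_sub (fun t => √(Λ t))] at hsum
  have hftrl := dualAveraging_regret hR0 hRmono x T hu
  have hRT : R T ≤ 2 * √(Λ T) + 4 * (D * M) := by
    refine Real.sqrt_le_iff.2 ⟨by positivity, ?_⟩
    rw [hcDM]
    have h1 := Real.sq_sqrt (hΛ0 T)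
    have h2 := Real.sqrt_nonneg (Λ T)
    nlinarith [mul_nonneg h2 hDM.le, sq_nonneg (D * M)]
  have h0 := Real.sqrt_nonneg (Λ 0)
  have hlast : 0 ≤ √(Λ T) := Real.sqrt_nonneg _
  linarith

/-! ### The scale: wealth of a fixed betting fraction -/

/-- One round of the wealth argument: `x` is the scaled loss, `y` the scaled missing mass, `δ` the
gap between the full and the known exponent. The term `x ^ 2` pays for the second order of the
exponential, and `2 |x| y` for using stale wealth, which costs at most `6 / 5 |x| y`. -/
theorem exp_neg_le_one_sub_mul_exp {x y δ : ℝ} (hx : |x| ≤ 1 / 60) (hy0 : 0 ≤ y)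
    (hy : y ≤ 1 / 40) (hδ : |δ| ≤ 9 / 8 * y) :
    Real.exp (-(x + x ^ 2 + 2 * |x| * y)) ≤ 1 - x * Real.exp δ := by
  have hx0 := abs_nonneg x
  have hδ0 := abs_nonneg δ
  have h1 : |Real.exp δ - 1| ≤ 6 / 5 * y := by
    have h2 := Real.abs_exp_sub_one_sub_id_le (show |δ| ≤ 1 by linarith)
    have h3 : |Real.exp δ - 1| ≤ |Real.exp δ - 1 - δ| + |δ| := by
      have := abs_add_le (Real.exp δ - 1 - δ) δ
      rwa [sub_add_cancel] at this
    have h4 : δ ^ 2 ≤ 9 / 8 * y * (9 / 8 * (1 / 40)) := by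
      rw [← sq_abs]
      nlinarith
    linarith
  have h2 : x * Real.exp δ ≤ x + 6 / 5 * (|x| * y) := by
    have h3 : x * (Real.exp δ - 1) ≤ |x| * (6 / 5 * y) :=
      (le_abs_self _).trans (by rw [abs_mul]; exact mul_le_mul_of_nonneg_left h1 hx0)
    linarith
  set a := x + x ^ 2 + 2 * |x| * y with ha
  have habs : |a| ≤ |x| * (27 / 25) := by
    have h3 : |a| ≤ |x| + |x| ^ 2 + 2 * |x| * y := by
      have h4 := abs_add_three x (x ^ 2) (2 * |x| * y)
      rwa [abs_of_nonneg (show 0 ≤ 2 * |x| * y by positivity), abs_pow] at h4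
    nlinarith
  have h3 : Real.exp (-a) ≤ 1 - a + 3 / 4 * a ^ 2 := by
    have h4 := Real.exp_bound (x := -a) (by rw [abs_neg]; linarith) (n := 2) (by norm_num)
    rw [abs_neg, sq_abs] at h4
    norm_num [Finset.sum_range_succ, Nat.factorial] at h4
    have h5 := (abs_le.1 h4).2
    linarith
  have h4 : a ^ 2 ≤ x ^ 2 * (27 / 25) ^ 2 := by
    rw [← sq_abs a, ← sq_abs x, ← mul_pow]
    exact pow_le_pow_left₀ (abs_nonneg a) habs 2
  have h5 : 0 ≤ |x| * y := by positivity
  nlinarith [sq_nonneg x]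

/-- The exponent of the scale algorithm when the time stamps in `A` are available. -/
noncomputable def lossExponent (γ : ℕ → Finset ℕ) (x : ℕ → ℝ) (A : Finset ℕ) (η : ℝ) : ℝ :=
  η * ∑ s ∈ A, x s + η ^ 2 * pairLag γ (fun s => |x s|) A

theorem scaleExponent_eq (ε : ℝ) (S γ : ℕ → Finset ℕ) (h : ℕ → ℝ) (t : ℕ) (η : ℝ) :
    scaleExponent ε S γ h t η = lossExponent γ (fun s => h s + ε) (S t) η := by
  rw [lossExponent, scaleExponent, pairLag, mul_sum, mul_sum, ← sum_add_distrib]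
  refine sum_congr rfl fun s _ => ?_
  rw [sq_abs]
  ring

theorem continuous_lossExponent (γ : ℕ → Finset ℕ) (x : ℕ → ℝ) (A : Finset ℕ) :
    Continuous (lossExponent γ x A) := by
  unfold lossExponent
  fun_prop

/-- The wealth of the constant betting fraction `η` bounds its delayed gains. -/
theorem sum_mul_exp_lossExponent_le {D : ℕ} {S γ : ℕ → Finset ℕ} (h : IsDelayed D S γ)
    (hD : 1 ≤ D) {x : ℕ → ℝ} {M : ℝ} (hM : 0 < M) {T : ℕ} (hx : ∀ s < T, |x s| ≤ M)
    {η : ℝ} (hη0 : 0 ≤ η) (hη : η ≤ (M * 20 * (1 + 2 * (D : ℝ)))⁻¹) :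
    ∑ t ∈ range T, η * x t * Real.exp (-lossExponent γ x (S t) η) ≤
      1 - Real.exp (-lossExponent γ x (range T) η) := by
  have hD' : (1 : ℝ) ≤ D := by exact_mod_cast hD
  have hn : ∀ s, 0 ≤ |x s| := fun s => abs_nonneg _
  have hηM : η * M * (20 * (1 + 2 * D)) ≤ 1 := by
    have h1 := mul_le_mul_of_nonneg_right hη (show 0 ≤ M * 20 * (1 + 2 * (D : ℝ)) by positivity)
    rw [inv_mul_cancel₀ (by positivity)] at h1
    linarith
  have hηM0 : 0 ≤ η * M := by positivity
  have hηMD : 0 ≤ η * M * D := by positivity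
  have hηMDle : η * M * D ≤ 1 / 40 := by linarith
  have hηMle : η * M ≤ 1 / 60 := by
    have := mul_le_mul_of_nonneg_left hD' hηM0
    linarith
  have key : ∀ n ≤ T, ∑ t ∈ range n, η * x t * Real.exp (-lossExponent γ x (S t) η) ≤
      1 - Real.exp (-lossExponent γ x (range n) η) := by
    intro n
    induction n with
    | zero => intro _; simp [lossExponent, pairLag]
    | succ t ih =>
      intro ht
      have hlt : ∀ s < t, |x s| ≤ M := fun s hs => hx s (by omega)
      set Y := ∑ i ∈ γ t, |x i| with hY
      have hY0 : 0 ≤ Y := sum_nonneg fun i _ => hn i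
      have hYle : Y ≤ D * M := h.sum_missing_le hM.le hlt
      set δ := lossExponent γ x (range t) η - lossExponent γ x (S t) η with hδ
      -- The linear part gives `η Y`, the unknown lag `5 η² D M Y`, and `5 η D M ≤ 1 / 8`.
      have hδabs : |δ| ≤ 9 / 8 * (η * Y) := by
        have e1 : δ = η * ∑ s ∈ γ t, x s + η ^ 2 *
            (pairLag γ (fun s => |x s|) (range t) - pairLag γ (fun s => |x s|) (S t)) := by
          rw [hδ, lossExponent, lossExponent, h.sum_eq_add x t]
          ring
        have h1 : pairLag γ (fun s => |x s|) (range t) - pairLag γ (fun s => |x s|) (S t) ≤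
            5 * D * M * Y := h.pairLag_sub_le hD hn hM.le hlt
        have h2 : 0 ≤ pairLag γ (fun s => |x s|) (range t) - pairLag γ (fun s => |x s|) (S t) :=
          sub_nonneg.2 (h.pairLag_le hn t)
        have h3 : |∑ s ∈ γ t, x s| ≤ Y := abs_sum_le_sum_abs _ _
        rw [e1]
        refine (abs_add_le _ _).trans ?_
        rw [abs_mul, abs_mul, abs_of_nonneg hη0, abs_of_nonneg (sq_nonneg η), abs_of_nonneg h2]
        have h4 := mul_le_mul_of_nonneg_left h3 hη0
        have h5 := mul_le_mul_of_nonneg_left h1 (sq_nonneg η)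
        have h6 := mul_le_mul_of_nonneg_right hηMDle (mul_nonneg hη0 hY0)
        nlinarith
      have hxt : |η * x t| ≤ 1 / 60 := by
        rw [abs_mul, abs_of_nonneg hη0]
        exact (mul_le_mul_of_nonneg_left (hx t (by omega)) hη0).trans hηMle
      have hyle : η * Y ≤ 1 / 40 := by
        have := mul_le_mul_of_nonneg_left hYle hη0
        linarith
      have hexp := exp_neg_le_one_sub_mul_exp hxt (mul_nonneg hη0 hY0) hyle hδabs
      have e2 : lossExponent γ x (range (t + 1)) η = lossExponent γ x (range t) η +
          (η * x t + (η * x t) ^ 2 + 2 * |η * x t| * (η * Y)) := by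
        rw [lossExponent, lossExponent, h.pairLag_range_succ, sum_range_succ, abs_mul,
          abs_of_nonneg hη0, sq_abs]
        ring
      have e3 : Real.exp (-lossExponent γ x (S t) η) =
          Real.exp (-lossExponent γ x (range t) η) * Real.exp δ := by
        rw [← Real.exp_add, hδ]
        ring_nf
      have h7 := mul_le_mul_of_nonneg_left hexp
        (Real.exp_nonneg (-lossExponent γ x (range t) η))
      rw [← Real.exp_add, ← neg_add, ← e2] at h7
      rw [sum_range_succ, e3]
      linarith [ih (by omega)]
  exact key T le_rfl

/-! ### The scale: mixture over the prior and conversion of wealth into regret -/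

section Prior

theorem gaussianMass_pos {a : ℝ} (ha : 0 < a) :
    0 < ∫ η in (0 : ℝ)..a, Real.exp (-η ^ 2) :=
  intervalIntegral.intervalIntegral_pos_of_pos
    (Continuous.intervalIntegrable (by fun_prop) _ _) (fun _ => Real.exp_pos _) ha

theorem gaussianMass_le {a : ℝ} (ha : 0 ≤ a) :
    ∫ η in (0 : ℝ)..a, Real.exp (-η ^ 2) ≤ a := by
  have : ∫ η in (0 : ℝ)..a, Real.exp (-η ^ 2) ≤ ∫ η in (0 : ℝ)..a, (1 : ℝ) :=
    intervalIntegral.integral_mono_on ha (Continuous.intervalIntegrable (by fun_prop) _ _)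
      (by simp) fun η _ => Real.exp_le_one_iff.2 (by nlinarith [sq_nonneg η])
  simpa using this

/-- The Gaussian weight keeps the normaliser bounded when `a` is large, where the bound by `a` says
little; this controls the `1` in `Λ + 1`. -/
theorem gaussianMass_le_one {a : ℝ} (ha : 0 ≤ a) :
    ∫ η in (0 : ℝ)..a, Real.exp (-η ^ 2) ≤ 1 := by
  have h1 : ∫ η in (0 : ℝ)..a, Real.exp (-η ^ 2) ≤ ∫ η in Set.Ioi (0 : ℝ), Real.exp (-η ^ 2) := by
    rw [intervalIntegral.integral_of_le ha]
    refine MeasureTheory.setIntegral_mono_set ?_ ?_ ?_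
    · have := (integrable_exp_neg_mul_sq (b := 1) one_pos).integrableOn (s := Set.Ioi (0 : ℝ))
      simpa using this
    · exact Filter.Eventually.of_forall fun _ => (Real.exp_pos _).le
    · exact Set.Ioc_subset_Ioi_self.eventuallyLE
  have h2 := integral_gaussian_Ioi 1
  simp only [neg_mul, one_mul, div_one] at h2
  rw [h2] at h1
  have h3 : √Real.pi ≤ 2 := Real.sqrt_le_iff.2 ⟨by norm_num, by linarith [Real.pi_le_four]⟩
  linarith

/-- The Gaussian mixture of the wealths has at least the wealth of the best fraction, up to the
prior mass around it. -/
theorem le_integral_wealth {a X V η₀ : ℝ} (hη₀ : 0 < η₀) (hη₀a : η₀ ≤ a) (hX : 2 * η₀ * V ≤ X)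
    (hV : 0 ≤ V) :
    η₀ / 2 * Real.exp (η₀ * X / 4) ≤
      ∫ η in (0 : ℝ)..a, Real.exp (η * X - η ^ 2 * V) := by
  have hint : ∀ b c : ℝ, IntervalIntegrable (fun η : ℝ => Real.exp (η * X - η ^ 2 * V))
      MeasureTheory.volume b c := fun b c => Continuous.intervalIntegrable (by fun_prop) b c
  have hX0 : 0 ≤ X := le_trans (by positivity) hX
  -- For `η` in `[η₀ / 2, η₀]` the quadratic term eats at most half of `η X`, leaving at least `η₀ X
  -- / 4`.
  have h1 : ∫ η in (η₀ / 2)..η₀, Real.exp (η₀ * X / 4) ≤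
      ∫ η in (η₀ / 2)..η₀, Real.exp (η * X - η ^ 2 * V) := by
    refine intervalIntegral.integral_mono_on (by linarith) (by simp) (hint _ _) fun η hη => ?_
    obtain ⟨h2, h3⟩ := hη
    refine Real.exp_le_exp.2 ?_
    have h4 : η * V ≤ X / 2 := by nlinarith
    have h5 : η * (η * V) ≤ η * (X / 2) := mul_le_mul_of_nonneg_left h4 (by linarith)
    nlinarith
  rw [intervalIntegral.integral_const, smul_eq_mul] at h1
  have h2 : ∫ η in (η₀ / 2)..η₀, Real.exp (η * X - η ^ 2 * V) ≤
      ∫ η in (0 : ℝ)..a, Real.exp (η * X - η ^ 2 * V) :=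
    intervalIntegral.integral_mono_interval (by linarith) (by linarith) hη₀a
      (Filter.Eventually.of_forall fun _ => (Real.exp_pos _).le) (hint _ _)
  refine le_trans (le_of_eq ?_) (h1.trans h2)
  ring

end Prior

theorem scale_nonneg {D : ℕ} {M ε ν : ℝ} (hMε : 0 ≤ M + ε) (hν : 0 ≤ ν) (S γ : ℕ → Finset ℕ)
    (h : ℕ → ℝ) (t : ℕ) : 0 ≤ scale D M ε ν S γ h t := by
  have ha : 0 ≤ etaMax D M ε := by unfold etaMax; positivity
  refine div_nonneg ?_ ?_
  · refine intervalIntegral.integral_nonneg ha fun η hη => ?_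
    have := hη.1
    positivity
  · exact intervalIntegral.integral_nonneg ha fun η _ => (Real.exp_pos _).le

/-- The losses of the scale algorithm are at most the initial wealth minus the final one. -/
theorem sum_scale_mul_le {D : ℕ} {S γ : ℕ → Finset ℕ} (hS : IsDelayed D S γ) (hD : 1 ≤ D)
    {M ε ν : ℝ} (hMε : 0 < M + ε) (hν : 0 ≤ ν) {h : ℕ → ℝ} {T : ℕ}
    (hx : ∀ s < T, |h s + ε| ≤ M + ε) :
    ∑ t ∈ range T, scale D M ε ν S γ h t * (h t + ε) ≤
      ν - ν * ((∫ η in (0 : ℝ)..etaMax D M ε,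
        Real.exp (η * (-∑ t ∈ range T, (h t + ε)) -
          η ^ 2 * (pairLag γ (fun s => |h s + ε|) (range T) + 1))) /
        ∫ η in (0 : ℝ)..etaMax D M ε, Real.exp (-η ^ 2)) := by
  have ha : 0 < etaMax D M ε := by unfold etaMax; positivity
  set a := etaMax D M ε with hadef
  set x : ℕ → ℝ := fun s => h s + ε with hxdef
  have hcont := continuous_lossExponent γ x
  have hZ := gaussianMass_pos ha
  set Z := ∫ η in (0 : ℝ)..a, Real.exp (-η ^ 2) with hZdef
  -- Exchanging sum and integral reduces the claim to the wealth bound for each `η`; the factor `exp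
  -- (-η ^ 2)` of the prior later turns `Λ` into `Λ + 1`.
  have e1 : ∑ t ∈ range T, scale D M ε ν S γ h t * (h t + ε) =
      (∫ η in (0 : ℝ)..a, ν * Real.exp (-η ^ 2) *
        ∑ t ∈ range T, η * x t * Real.exp (-lossExponent γ x (S t) η)) / Z := by
    simp only [mul_sum]
    rw [intervalIntegral.integral_finsetSum, sum_div]
    · refine sum_congr rfl fun t _ => ?_
      rw [scale, div_mul_eq_mul_div, ← intervalIntegral.integral_mul_const]
      congr 1
      refine intervalIntegral.integral_congr fun η _ => ?_
      simp only [scaleExponent_eq]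
      ring
    · intro t _
      have := hcont (S t)
      exact Continuous.intervalIntegrable (by fun_prop) _ _
  have hcT := hcont (range T)
  have h2 : (∫ η in (0 : ℝ)..a, ν * Real.exp (-η ^ 2) *
      ∑ t ∈ range T, η * x t * Real.exp (-lossExponent γ x (S t) η)) ≤
      ∫ η in (0 : ℝ)..a, ν * Real.exp (-η ^ 2) *
        (1 - Real.exp (-lossExponent γ x (range T) η)) := by
    refine intervalIntegral.integral_mono_on ha.le ?_ ?_ fun η hη => ?_
    · refine Continuous.intervalIntegrable ?_ _ _
      refine Continuous.mul (by fun_prop) (continuous_finsetSum _ fun t _ => ?_)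
      have := hcont (S t)
      fun_prop
    · exact Continuous.intervalIntegrable (by fun_prop) _ _
    · refine mul_le_mul_of_nonneg_left ?_ (by positivity)
      exact sum_mul_exp_lossExponent_le hS hD hMε hx hη.1 hη.2
  have e3 : (∫ η in (0 : ℝ)..a, ν * Real.exp (-η ^ 2) *
        (1 - Real.exp (-lossExponent γ x (range T) η))) =
      ν * Z - ν * ∫ η in (0 : ℝ)..a, Real.exp (η * (-∑ t ∈ range T, (h t + ε)) -
          η ^ 2 * (pairLag γ (fun s => |h s + ε|) (range T) + 1)) := by
    rw [hZdef, ← intervalIntegral.integral_const_mul, ← intervalIntegral.integral_const_mul,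
      ← intervalIntegral.integral_sub (Continuous.intervalIntegrable (by fun_prop) _ _)
        (Continuous.intervalIntegrable (by fun_prop) _ _)]
    refine intervalIntegral.integral_congr fun η _ => ?_
    rw [mul_sub, mul_one, mul_assoc ν, ← Real.exp_add, lossExponent]
    congr 3
    change _ = η * (-∑ t ∈ range T, x t) -
      η ^ 2 * (pairLag γ (fun s => |x s|) (range T) + 1)
    ring_nf
  rw [e1]
  refine (div_le_div_of_nonneg_right (h2.trans_eq e3) hZ.le).trans_eq ?_
  rw [sub_div, mul_div_cancel_right₀ _ hZ.ne', mul_div_assoc]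

/-- Conversion of wealth into regret: the convex dual of the Gaussian mixture. -/
theorem mul_sub_wealth_le {a X Λ U ν L P : ℝ} (ha : 0 < a) (hΛ : 0 ≤ Λ) (hU : 0 ≤ U)
    (hν : 0 < ν) (hL : 1 ≤ L) (hXP : X ≤ 7 * P) (hΛP : Λ * a ≤ P) (haP : 1 ≤ 420 * P * a)
    (hUP : U * P ≤ ν * Real.exp L) :
    U * X - ν * ((∫ η in (0 : ℝ)..a, Real.exp (η * X - η ^ 2 * (Λ + 1))) /
        ∫ η in (0 : ℝ)..a, Real.exp (-η ^ 2)) ≤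
      U * (80 * (√((Λ + 1) * L) + L / a)) := by
  have hZ := gaussianMass_pos ha
  have hZa := gaussianMass_le ha.le
  have hZ1 := gaussianMass_le_one ha.le
  set Z := ∫ η in (0 : ℝ)..a, Real.exp (-η ^ 2) with hZdef
  set W := ∫ η in (0 : ℝ)..a, Real.exp (η * X - η ^ 2 * (Λ + 1)) with hW
  have hP0 : 0 < P := by
    by_contra! hP
    nlinarith
  have hW0 : 0 ≤ W := intervalIntegral.integral_nonneg ha.le fun η _ => (Real.exp_pos _).le
  set V := Λ + 1 with hV
  have hV1 : 1 ≤ V := by linarith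
  have hsq0 := Real.sqrt_nonneg (V * L)
  have hsq := Real.sq_sqrt (show 0 ≤ V * L by positivity)
  have hLa : 0 < L / a := by positivity
  -- For small `X` the wealth can be dropped. For large `X` the wealth alone must exceed `U X`.
  by_cases hX : X ≤ 80 * (√(V * L) + L / a)
  · have h1 := mul_le_mul_of_nonneg_left hX hU
    have h2 : 0 ≤ ν * (W / Z) := by positivity
    linarith
  push Not at hX
  have hX1 : 80 * √(V * L) < X := by linarith
  have hX2 : 80 * L < X * a := by
    have h1 : 80 * (L / a) < X := by linarith
    rw [← mul_div_assoc, div_lt_iff₀ ha] at h1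
    exact h1
  have hX0 : 0 < X := by linarith
  have hXone : 1 ≤ X := by
    have : 1 ≤ √(V * L) := Real.one_le_sqrt.2 (by nlinarith)
    linarith
  suffices hmain : U * X ≤ ν * (W / Z) by
    have : 0 ≤ U * (80 * (√(V * L) + L / a)) := by positivity
    linarith
  rw [← mul_div_assoc, le_div_iff₀ hZ]
  -- The optimal fraction is of order `X / (2 V)`; if it lies beyond the range, `η₀ = a` is used
  -- instead.
  by_cases hcase : 2 * a * V ≤ X
  · have h1 := le_integral_wealth ha le_rfl hcase (by linarith)
    -- Half of the exponent supplies the linear factor in `X`, the other half the power of `exp L`.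
    have h2 : X * a / 8 * Real.exp (10 * L) ≤ Real.exp (a * X / 4) := by
      have h3 : X * a / 8 ≤ Real.exp (X * a / 8) := by
        linarith [Real.add_one_le_exp (X * a / 8)]
      have h4 : Real.exp (10 * L) ≤ Real.exp (X * a / 8) := Real.exp_le_exp.2 (by linarith)
      calc _ ≤ Real.exp (X * a / 8) * Real.exp (X * a / 8) :=
            mul_le_mul h3 h4 (Real.exp_pos _).le (Real.exp_pos _).le
        _ = _ := by rw [← Real.exp_add]; ring_nf
    have h5 : 6720 * Real.exp L ≤ Real.exp (10 * L) := by
      have h6 : Real.exp (10 * L) = Real.exp (9 * L) * Real.exp L := by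
        rw [← Real.exp_add]; ring_nf
      have h7 : (6720 : ℝ) ≤ Real.exp (9 * L) := by
        have h8 : Real.exp 9 ≤ Real.exp (9 * L) := Real.exp_le_exp.2 (by linarith)
        have h9 : Real.exp 9 = Real.exp 1 ^ 9 := by rw [← Real.exp_nat_mul]; norm_num
        have h10 : (2.7182818283 : ℝ) ^ 9 ≤ Real.exp 1 ^ 9 :=
          pow_le_pow_left₀ (by norm_num) Real.exp_one_gt_d9.le 9
        have h11 : (6720 : ℝ) ≤ 2.7182818283 ^ 9 := by norm_num
        linarith
      rw [h6]
      exact mul_le_mul_of_nonneg_right h7 (Real.exp_pos _).le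
    have h6 : U ≤ 420 * a * (ν * Real.exp L) := by
      calc U = U * 1 := (mul_one U).symm
        _ ≤ U * (420 * P * a) := mul_le_mul_of_nonneg_left haP hU
        _ = 420 * a * (U * P) := by ring
        _ ≤ _ := mul_le_mul_of_nonneg_left hUP (by positivity)
    calc U * X * Z ≤ 420 * a * (ν * Real.exp L) * X * a := by gcongr
      _ = ν * (a / 2 * (X * a / 8 * (6720 * Real.exp L))) := by ring
      _ ≤ ν * (a / 2 * (X * a / 8 * Real.exp (10 * L))) := by gcongr
      _ ≤ ν * (a / 2 * Real.exp (a * X / 4)) := by gcongr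
      _ ≤ ν * W := by gcongr
  · push Not at hcase
    have hη₀ : X / (2 * V) ≤ a := by
      rw [div_le_iff₀ (by positivity)]
      linarith
    have hη₀V : 2 * (X / (2 * V)) * V ≤ X := by
      refine le_of_eq ?_
      field_simp
    have h1 := le_integral_wealth (by positivity) hη₀ hη₀V (by linarith)
    have h2 : 800 * L ≤ X / (2 * V) * X / 4 := by
      rw [div_mul_eq_mul_div, div_div, le_div_iff₀ (by positivity)]
      have h3 := mul_self_le_mul_self (by positivity) hX1.le
      nlinarith
    have h3 : 32 * Real.exp L ≤ Real.exp (X / (2 * V) * X / 4) := by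
      have h4 : Real.exp (100 * L + L) ≤ Real.exp (X / (2 * V) * X / 4) :=
        Real.exp_le_exp.2 (by linarith)
      rw [Real.exp_add] at h4
      have h5 : 32 ≤ Real.exp (100 * L) := by linarith [Real.add_one_le_exp (100 * L)]
      exact (mul_le_mul_of_nonneg_right h5 (Real.exp_pos _).le).trans h4
    -- Here `Λ Z ≤ Λ a ≤ P`, while `Z ≤ 1 ≤ X ≤ 7 P`.
    have hVZ : V * Z ≤ 8 * P := by
      have h4 : Λ * Z ≤ Λ * a := mul_le_mul_of_nonneg_left hZa hΛ
      rw [hV, add_mul]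
      linarith
    have h4 : U * (V * Z) * 4 ≤ ν * (32 * Real.exp L) := by
      have h5 := mul_le_mul_of_nonneg_left hVZ hU
      linarith
    calc U * X * Z = U * (V * Z) * 4 * (X / (4 * V)) := by field_simp
      _ ≤ ν * (32 * Real.exp L) * (X / (4 * V)) := by gcongr
      _ ≤ ν * Real.exp (X / (2 * V) * X / 4) * (X / (4 * V)) := by gcongr
      _ = ν * (X / (2 * V) / 2 * Real.exp (X / (2 * V) * X / 4)) := by ring_nf
      _ ≤ ν * W := by gcongr

/-! ### The coding error and the assembly of the bound -/

theorem IsDelayed.pairLag_add_const_le {D : ℕ} {S γ : ℕ → Finset ℕ} (h : IsDelayed D S γ)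
    (hD : 1 ≤ D) {x : ℕ → ℝ} {G m : ℝ} (hG : 0 ≤ G) (hm : 0 ≤ m)
    (hmG : m ≤ 6 * G) {T : ℕ} (hxG : ∀ s < T, x s ≤ G) :
    pairLag γ (fun s => x s + m) (range T) ≤
      pairLag γ x (range T) + 24 * (m * T) * (G * D) := by
  have hD' : (1 : ℝ) ≤ D := by exact_mod_cast hD
  rw [h.pairLag_range, h.pairLag_range]
  have key : ∀ s ∈ range T, (x s + m) ^ 2 + 2 * (x s + m) * ∑ i ∈ γ s, (x i + m) ≤
      (x s ^ 2 + 2 * x s * ∑ i ∈ γ s, x i) + 24 * m * (G * D) := by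
    intro s hs
    have hs' := mem_range.1 hs
    have h1 := h.sum_missing_le hG (t := s) fun i hi => hxG i (hi.trans hs')
    have h2 : ((γ s).card : ℝ) ≤ D := by exact_mod_cast h.card_missing_le s
    rw [sum_add_distrib, sum_const, nsmul_eq_mul]
    set Y := ∑ i ∈ γ s, x i
    set n : ℝ := ((γ s).card : ℝ)
    have hn : 0 ≤ n := Nat.cast_nonneg _
    have hxs := hxG s hs'
    have h3 : m * x s ≤ m * (G * D) :=
      mul_le_mul_of_nonneg_left (by nlinarith) hm
    have h4 : m * m ≤ m * (6 * (G * D)) :=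
      mul_le_mul_of_nonneg_left (by nlinarith) hm
    have h5 : x s * n ≤ G * D := mul_le_mul hxs h2 hn hG
    have h6 : m * n ≤ 6 * G * D := mul_le_mul hmG h2 hn (by positivity)
    have h7 := mul_le_mul_of_nonneg_left h5 hm
    have h8 := mul_le_mul_of_nonneg_left h6 hm
    have h9 := mul_le_mul_of_nonneg_left h1 hm
    linarith
  refine (sum_le_sum key).trans_eq ?_
  rw [sum_add_distrib, sum_const, card_range, nsmul_eq_mul]
  ring

/-- AM-GM, used with `p = ε T` and `q = G D L`: the growth of the lag due to coding separates into
the two lower-order terms. -/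
theorem sqrt_add_mul_le {A p q : ℝ} (hA : 0 ≤ A) (hp : 0 ≤ p) (hq : 0 ≤ q) :
    √(A + 48 * (p * q)) ≤ √A + 4 * (p + q) := by
  refine Real.sqrt_le_iff.2 ⟨by positivity, ?_⟩
  have h1 : 0 ≤ √A * (p + q) := by positivity
  nlinarith [Real.sq_sqrt hA, sq_nonneg (p - q), mul_nonneg hp hq]

theorem coverRadius_le {d k : ℕ} {G : ℝ} (hG : 0 ≤ G) : coverRadius d k G ≤ 3 * G := by
  have h : (2 : ℝ) ^ (-((k : ℝ) / (d : ℝ))) ≤ 1 :=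
    Real.rpow_le_one_of_one_le_of_nonpos (by norm_num) (neg_nonpos.2 (by positivity))
  unfold coverRadius
  nlinarith

theorem coverRadius_nonneg {d k : ℕ} {G : ℝ} (hG : 0 ≤ G) : 0 ≤ coverRadius d k G := by
  unfold coverRadius; positivity

/-- Rounding `b / D` down loses less than one bit per gradient, hence at most a factor `2 ^ (1 / d)
≤ 2` in the radius. -/
theorem coverRadius_div_le {d b D : ℕ} (hd : 0 < d) (hD : 0 < D) {G : ℝ} (hG : 0 ≤ G) :
    coverRadius d (b / D) G ≤ 6 * ((2 : ℝ) ^ (-((b : ℝ) / ((d : ℝ) * (D : ℝ)))) * G) := by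
  have hd' : (1 : ℝ) ≤ d := by exact_mod_cast hd
  have hD' : (0 : ℝ) < D := by exact_mod_cast hD
  have h1 : (b : ℝ) ≤ D * ((b / D : ℕ) + 1) := by
    exact_mod_cast (Nat.lt_mul_div_succ b hD).le
  have h2 : (b : ℝ) / ((d : ℝ) * (D : ℝ)) ≤ ((b / D : ℕ) : ℝ) / d + 1 := by
    rw [div_le_iff₀ (by positivity)]
    have h3 : (((b / D : ℕ) : ℝ) / d + 1) * (d * D) = D * ((b / D : ℕ) + d) := by
      field_simp
    rw [h3]
    exact h1.trans (mul_le_mul_of_nonneg_left (by linarith) hD'.le)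
  have h4 : (2 : ℝ) ^ (-(((b / D : ℕ) : ℝ) / d)) ≤
      2 * (2 : ℝ) ^ (-((b : ℝ) / ((d : ℝ) * (D : ℝ)))) := by
    rw [mul_comm, ← Real.rpow_add_one (by norm_num)]
    exact Real.rpow_le_rpow_of_exponent_le (by norm_num) (by linarith)
  unfold coverRadius
  nlinarith [mul_le_mul_of_nonneg_right h4 hG]

/-- The regret of one round, split into the regrets of scale and direction and the coding error. -/
theorem inner_smul_sub_le {d : ℕ} {g g' z u w : Vec d} {v ε : ℝ} (hv : 0 ≤ v)
    (hz : ‖z‖ ≤ 1) (hw : ‖u‖ • w = u) (hg : ‖g - g'‖ ≤ ε) :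
    inner ℝ g (v • z - u) ≤ v * (inner ℝ z g' + ε) - ‖u‖ * (inner ℝ z g' + ε) +
      ‖u‖ * inner ℝ g' (z - w) + 2 * ε * ‖u‖ := by
  have hε : 0 ≤ ε := (norm_nonneg _).trans hg
  -- The part `ε v` is absorbed in the shifted loss; subtracting the same shift at `‖u‖` raises the
  -- remaining `ε ‖u‖` to `2 ε ‖u‖`.
  have h1 : inner ℝ (g - g') (v • z - u) ≤ ε * (v + ‖u‖) := by
    refine (real_inner_le_norm _ _).trans (mul_le_mul hg ?_ (norm_nonneg _) hε)
    refine (norm_sub_le _ _).trans (add_le_add_left ?_ _)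
    rw [norm_smul, Real.norm_of_nonneg hv]
    exact mul_le_of_le_one_right hv hz
  have h2 : inner ℝ g' u = ‖u‖ * inner ℝ g' w := by
    conv_lhs => rw [← hw]
    rw [real_inner_smul_right]
  rw [inner_sub_left, inner_sub_right g', real_inner_smul_right g', h2] at h1
  rw [inner_sub_right g' z w, real_inner_comm z g'] at *
  linarith

theorem one_le_logFactor {U G ν : ℝ} (hU : 0 ≤ U) (hG : 0 ≤ G) (hν : 0 ≤ ν) (D T : ℕ) :
    1 ≤ logFactor U G ν D T := by
  have h : 0 ≤ U * G * (D : ℝ) * (T : ℝ) / ν := by positivity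
  rw [logFactor, Real.le_log_iff_exp_le (by positivity)]
  linarith

theorem mul_le_exp_logFactor {U G ν : ℝ} (hU : 0 ≤ U) (hG : 0 ≤ G) (hν : 0 < ν) (D T : ℕ) :
    U * (G * D * T) ≤ ν * Real.exp (logFactor U G ν D T) := by
  have h : 0 ≤ U * G * (D : ℝ) * (T : ℝ) / ν := by positivity
  rw [logFactor, Real.exp_log (by positivity), mul_add, mul_div_cancel₀ _ hν.ne']
  nlinarith [mul_pos hν (Real.exp_pos 1)]

/-- The scale algorithm competes with every `U ≥ 0`. -/
theorem scale_regret {D : ℕ} {S γ : ℕ → Finset ℕ} (hS : IsDelayed D S γ) (hD : 1 ≤ D)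
    {G ε ν U : ℝ} (hG : 0 < G) (hε : 0 ≤ ε) (hεG : ε ≤ 3 * G) (hν : 0 < ν) (hU : 0 ≤ U)
    {h : ℕ → ℝ} {T : ℕ} (hT : 1 ≤ T) (hx : ∀ s < T, |h s + ε| ≤ 4 * G + ε) :
    ∑ t ∈ range T, (scale D (4 * G) ε ν S γ h t - U) * (h t + ε) ≤
      ν + U * (80 * (√((pairLag γ (fun s => |h s + ε|) (range T) + 1) *
        logFactor U G ν D T) + 420 * (G * D * logFactor U G ν D T))) := by
  have hD' : (1 : ℝ) ≤ D := by exact_mod_cast hD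
  have hT' : (1 : ℝ) ≤ T := by exact_mod_cast hT
  set M := 4 * G + ε with hM
  have hM0 : 0 < M := by positivity
  have hM7 : M ≤ 7 * G := by linarith
  set a := etaMax D (4 * G) ε with ha
  have hainv : a⁻¹ = M * 20 * (1 + 2 * D) := by rw [ha, etaMax, inv_inv]
  have ha0 : 0 < a := by
    rw [← inv_pos, hainv]; positivity
  -- `420 = 20 · 7 · 3`, from `M ≤ 7 G` and `1 + 2 D ≤ 3 D`.
  have hainv_le : a⁻¹ ≤ 420 * (G * D) := by
    rw [hainv]
    have : M * (1 + 2 * D) ≤ (7 * G) * (3 * D) :=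
      mul_le_mul hM7 (by linarith) (by positivity) (by positivity)
    linarith
  have hGDT : G * T ≤ G * D * T := by
    have : G * 1 * T ≤ G * D * T := by gcongr
    simpa using this
  set Λ := pairLag γ (fun s => |h s + ε|) (range T) with hΛ
  have hΛ0 : 0 ≤ Λ := pairLag_nonneg (fun _ => abs_nonneg _) _
  set L := logFactor U G ν D T with hL
  have hL1 : 1 ≤ L := one_le_logFactor hU hG.le hν.le D T
  have hX : -∑ t ∈ range T, (h t + ε) ≤ 7 * (G * D * T) := by
    have h1 : -∑ t ∈ range T, (h t + ε) ≤ ∑ t ∈ range T, |h t + ε| :=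
      (neg_le_abs _).trans (abs_sum_le_sum_abs _ _)
    have h2 : ∑ t ∈ range T, |h t + ε| ≤ ∑ t ∈ range T, M :=
      sum_le_sum fun t ht => hx t (mem_range.1 ht)
    rw [sum_const, card_range, nsmul_eq_mul] at h2
    have h3 : T * M ≤ T * (7 * G) := by gcongr
    linarith
  have hΛa : Λ * a ≤ G * D * T := by
    have h1 : Λ ≤ T * (M ^ 2 * (1 + 2 * D)) :=
      hS.pairLag_range_le (fun _ => abs_nonneg _) hM0.le hx
    rw [← le_div_iff₀ ha0, div_eq_mul_inv, hainv]
    refine h1.trans ?_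
    have h2 : M * (T * M * (1 + 2 * D)) ≤ (20 * (G * D)) * (T * M * (1 + 2 * D)) := by
      refine mul_le_mul_of_nonneg_right ?_ (by positivity)
      nlinarith
    linarith
  have haP : 1 ≤ 420 * (G * D * T) * a := by
    rw [← div_le_iff₀ ha0, one_div]
    refine hainv_le.trans ?_
    have : G * D * 1 ≤ G * D * T := by gcongr
    linarith
  have hdual := mul_sub_wealth_le ha0 hΛ0 hU hν hL1 hX hΛa haP
    (mul_le_exp_logFactor hU hG.le hν D T)
  have hwealth := sum_scale_mul_le hS hD hM0 hν.le hx
  have hLa : L / a ≤ 420 * (G * D * L) := by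
    rw [div_eq_mul_inv]
    have := mul_le_mul_of_nonneg_left hainv_le (show 0 ≤ L by linarith)
    linarith
  have hfin : U * (80 * (√((Λ + 1) * L) + L / a)) ≤
      U * (80 * (√((Λ + 1) * L) + 420 * (G * D * L))) := by gcongr
  simp only [sub_mul, sum_sub_distrib, ← mul_sum]
  linarith

theorem norm_smul_inv_smul_self {d : ℕ} (u : Vec d) : ‖u‖ • (‖u‖⁻¹ • u) = u := by
  by_cases h : u = 0
  · simp [h]
  · rw [smul_smul, mul_inv_cancel₀ (norm_ne_zero_iff.2 h), one_smul]

/-- The regret bound for an arbitrary pattern of delays, in terms of the coding error `ε`. -/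
theorem delayed_regret {d D : ℕ} {S γ : ℕ → Finset ℕ} (hS : IsDelayed D S γ) (hD : 1 ≤ D)
    {G ε ν : ℝ} (hG : 0 < G) (hε : 0 ≤ ε) (hεG : ε ≤ 3 * G) (hν : 0 < ν) {T : ℕ} (hT : 1 ≤ T)
    {g g' : ℕ → Vec d} (hg : ∀ t < T, ‖g t‖ ≤ G) (hgg' : ∀ t < T, ‖g t - g' t‖ ≤ ε) (u : Vec d) :
    ∑ t ∈ range T, inner ℝ (g t) (scale D (4 * G) ε ν S γ
        (fun s => inner ℝ (adaDelayDist D (4 * G) S γ g' s) (g' s)) t •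
          adaDelayDist D (4 * G) S γ g' t - u) ≤
      ν + ‖u‖ * (84 * √((pairLag γ (fun s => ‖g s‖) (range T) + 1) * logFactor ‖u‖ G ν D T) +
        34000 * (G * D * logFactor ‖u‖ G ν D T) + 338 * (ε * T)) := by
  have hD' : (1 : ℝ) ≤ D := by exact_mod_cast hD
  set z := adaDelayDist D (4 * G) S γ g' with hz
  set h : ℕ → ℝ := fun s => inner ℝ (z s) (g' s) with hh
  set v := scale D (4 * G) ε ν S γ h with hv
  set L := logFactor ‖u‖ G ν D T with hL
  have hL1 : 1 ≤ L := one_le_logFactor (norm_nonneg u) hG.le hν.le D T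
  set Λ := pairLag γ (fun s => ‖g s‖) (range T) with hΛ
  have hΛ0 : 0 ≤ Λ := pairLag_nonneg (fun _ => norm_nonneg _) _
  have hg'n : ∀ t < T, ‖g' t‖ ≤ ‖g t‖ + ε := fun t ht => by
    have h1 := norm_sub_le (g t) (g t - g' t)
    rw [sub_sub_cancel] at h1
    linarith [hgg' t ht]
  have hz1 : ∀ t, ‖z t‖ ≤ 1 := fun t => norm_projUnitBall_le _
  have hhn : ∀ t, |h t| ≤ ‖g' t‖ := fun t =>
    (abs_real_inner_le_norm _ _).trans (mul_le_of_le_one_left (norm_nonneg _) (hz1 t))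
  have hhε : ∀ t, |h t + ε| ≤ ‖g' t‖ + ε := fun t =>
    (abs_add_le _ _).trans (by rw [abs_of_nonneg hε]; linarith [hhn t])
  -- For `u = 0` this is the zero vector, and `‖u‖ • w = u` still holds.
  set w : Vec d := ‖u‖⁻¹ • u with hw
  have hw1 : ‖w‖ ≤ 1 := by
    rw [hw, norm_smul, norm_inv, norm_norm]
    exact inv_mul_le_one
  have hstep : ∀ t ∈ range T, inner ℝ (g t) (v t • z t - u) ≤
      (v t - ‖u‖) * (h t + ε) + ‖u‖ * inner ℝ (g' t) (z t - w) + 2 * ε * ‖u‖ := by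
    intro t ht
    have := inner_smul_sub_le (v := v t) (scale_nonneg (by positivity) hν.le S γ h t) (hz1 t)
      (norm_smul_inv_smul_self u) (hgg' t (mem_range.1 ht))
    rw [sub_mul]
    exact this
  have hsum := sum_le_sum hstep
  rw [sum_add_distrib, sum_add_distrib, ← mul_sum, sum_const, card_range, nsmul_eq_mul] at hsum
  have hdir : ∑ t ∈ range T, inner ℝ (g' t) (z t - w) ≤
      4 * √(pairLag γ (fun s => ‖g' s‖) (range T)) + 2 * D * (4 * G) :=
    adaDelayDist_regret hS hD (by positivity)
      (fun s hs => by linarith [hg'n s hs, hg s hs]) hw1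
  have hscale := scale_regret hS hD hG hε hεG hν (norm_nonneg u) (h := h) hT
    (fun s hs => by linarith [hhε s, hg'n s hs, hg s hs])
  have hLag : pairLag γ (fun s => ‖g s‖ + 2 * ε) (range T) ≤ Λ + 48 * (ε * T * (G * D)) := by
    have := hS.pairLag_add_const_le hD hG.le
      (show 0 ≤ 2 * ε by positivity) (by linarith) hg
    linarith
  have hbound : ∀ A : ℝ, A ≤ Λ + 48 * (ε * T * (G * D)) →
      √((A + 1) * L) ≤ √((Λ + 1) * L) + 4 * (ε * T + G * D * L) := by
    intro A hA
    refine (Real.sqrt_le_sqrt ?_).trans (sqrt_add_mul_le (by positivity) (by positivity) (by positivity))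
    have := mul_le_mul_of_nonneg_right hA (show 0 ≤ L by linarith)
    linarith
  have h1 := hbound (pairLag γ (fun s => |h s + ε|) (range T))
    ((pairLag_mono (fun _ => abs_nonneg _) fun s hs => by linarith [hhε s, hg'n s hs]).trans hLag)
  have h2 := hbound (pairLag γ (fun s => ‖g' s‖) (range T))
    ((pairLag_mono (fun _ => norm_nonneg _) fun s hs => by linarith [hg'n s hs]).trans hLag)
  have h3 : √(pairLag γ (fun s => ‖g' s‖) (range T)) ≤
      √((pairLag γ (fun s => ‖g' s‖) (range T) + 1) * L) := by
    refine Real.sqrt_le_sqrt ?_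
    have : 0 ≤ pairLag γ (fun s => ‖g' s‖) (range T) := pairLag_nonneg (fun _ => norm_nonneg _) _
    nlinarith
  have h4 : G * D * 1 ≤ G * D * L := by gcongr
  have hεT : 0 ≤ ε * T := by positivity
  -- The constants: `80 + 4 = 84`, `80 · 420 + 84 · 4 + 8 ≤ 34000` and `84 · 4 + 2 = 338`.
  have h5 : 80 * (√((pairLag γ (fun s => |h s + ε|) (range T) + 1) * L) + 420 * (G * D * L)) +
      (4 * √(pairLag γ (fun s => ‖g' s‖) (range T)) + 2 * D * (4 * G)) + 2 * (ε * T) ≤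
      84 * √((Λ + 1) * L) + 34000 * (G * D * L) + 338 * (ε * T) := by
    have h6 : 0 ≤ G * D * L := by positivity
    linarith
  have h6 := mul_le_mul_of_nonneg_left h5 (norm_nonneg u)
  have h7 := mul_le_mul_of_nonneg_left hdir (norm_nonneg u)
  linarith

end DOCO

theorem mainTheorem5 :
    ∃ C : ℝ, 0 < C ∧
      ∀ (V : Type*) [Finite V] [Nontrivial V] (Gr : SimpleGraph V) (d b : ℕ) (G ν : ℝ),
        Gr.Connected → 0 < d → 0 < G → 0 < ν →
        Nonempty (DOCO.CoverCode d (b / Gr.diam) G) ∧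
        ∀ (c : DOCO.CoverCode d (b / Gr.diam) G) (T : ℕ) (I : ℕ → V)
          (ℓ : ℕ → DOCO.Vec d → ℝ) (g : ℕ → DOCO.Vec d),
          (∀ t < T, ConvexOn ℝ Set.univ (ℓ t)) →
          (∀ t < T, DOCO.IsSubgradient (ℓ t) (DOCO.play Gr ν c I g t) (g t)) →
          (∀ t < T, ‖g t‖ ≤ G) →
          (∀ t < T, ∀ n : V, DOCO.bitsSent Gr I (b / Gr.diam) t n ≤ b) ∧
          ∀ u : DOCO.Vec d,
            DOCO.regret ℓ (DOCO.play Gr ν c I g) T u ≤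
              ν + ‖u‖ * (C *
                (√((DOCO.lag Gr I g T + 1) * DOCO.logFactor ‖u‖ G ν Gr.diam T)
                  + G * (Gr.diam : ℝ) * DOCO.logFactor ‖u‖ G ν Gr.diam T
                  + (T : ℝ) * (2 : ℝ) ^ (-((b : ℝ) / ((d : ℝ) * (Gr.diam : ℝ)))) * G)) := by
  refine ⟨34000, by norm_num, ?_⟩
  intro V _ _ Gr d b G ν hconn hd hG hν
  refine ⟨DOCO.nonempty_coverCode hd _ hG, ?_⟩
  intro c T I ℓ g _ hsub hg
  refine ⟨fun t _ n => DOCO.bitsSent_le Gr I hconn b t n, fun u => ?_⟩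
  have hD : 1 ≤ Gr.diam := Nat.one_le_iff_ne_zero.2 (SimpleGraph.connected_iff_diam_ne_zero.1 hconn)
  have hS := DOCO.isDelayed_network hconn I
  set L := DOCO.logFactor ‖u‖ G ν Gr.diam T with hL
  have hL1 : 1 ≤ L := DOCO.one_le_logFactor (norm_nonneg u) hG.le hν.le _ T
  set p : ℝ := (2 : ℝ) ^ (-((b : ℝ) / ((d : ℝ) * (Gr.diam : ℝ)))) with hp
  -- The wealth conversion takes `P = G D T`, which has to be positive, so the empty game is treated
  -- apart.
  rcases Nat.eq_zero_or_pos T with rfl | hT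
  · have : DOCO.regret ℓ (DOCO.play Gr ν c I g) 0 u = 0 := by simp [DOCO.regret]
    rw [this]
    positivity
  have hmain := DOCO.delayed_regret hS hD hG (DOCO.coverRadius_nonneg hG.le)
    (DOCO.coverRadius_le hG.le) hν hT hg (g' := fun t => c.approx (g t))
    (fun t ht => c.mem_ball (g t) (hg t ht)) u
  have hlin : DOCO.regret ℓ (DOCO.play Gr ν c I g) T u ≤
      ∑ t ∈ Finset.range T, inner ℝ (g t) (DOCO.play Gr ν c I g t - u) := by
    refine Finset.sum_le_sum fun t ht => ?_
    have h1 := hsub t (Finset.mem_range.1 ht) u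
    rw [← neg_sub, inner_neg_right] at h1
    linarith
  refine (hlin.trans hmain).trans ?_
  have hlag : DOCO.lag Gr I g T =
      DOCO.pairLag (DOCO.missing Gr I) (fun s => ‖g s‖) (Finset.range T) :=
    (hS.pairLag_range (fun s => ‖g s‖) T).symm
  rw [← hlag]
  have hcov : DOCO.coverRadius d (b / Gr.diam) G * T ≤ 6 * (p * G) * T :=
    mul_le_mul_of_nonneg_right (DOCO.coverRadius_div_le hd hD hG.le) (Nat.cast_nonneg T)
  have hpos : 0 ≤ p * G * T := by positivity
  have hsq := Real.sqrt_nonneg ((DOCO.lag Gr I g T + 1) * L)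
  gcongr
  linarith
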